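/- Let $X$ be a real random variable with $\mathsf{E}[X^2]=\sigma^2$, $\zeta:=\mathsf{E}[X^4]<\infty$, $\mathsf{E}[X^6]<\infty$, and let $0<D<\sigma^2$. Let $X^n=(X_1,\dots,X_n)$ consist of independent copies of $X$, and put $d(x^n,y^n):=\frac1n\sum_{i=1}^n(x_i-y_i)^2$. A random codebook consists of $M$ codewords $Y^n(1),\dots,Y^n(M)$ in $\mathbb{R}^n$, independent of each other and of $X^n$ and identically distributed: for the spherical codebook each is uniform on the sphere of radius $\sqrt{n(\sigma^2-D)}$ centred at the origin; for the i.i.d. Gaussian codebook each has independent $\mathcal{N}(0,\sigma^2-D)$ coordinates. The encoder sends an index $f(X^n)\in\arg\min_{1\le i\le M}d(X^n,Y^n(i))$, the decoder outputs $Y^n(f(X^n))$, and the ensemble excess-distortion probability is $\mathrm{P}_{\mathrm{e},n}(M):=\Pr\{d(X^n,Y^n(f(X^n)))>D\}$, where the probability is over the source and the codebook. All logarithms are natural. Let $R^*(\sigma^2,D):=\frac12\log\frac{\sigma^2}{D}$ and $$\mathrm{V}(\sigma^2,\zeta):=\frac{\zeta-\sigma^4}{4\sigma^4}.$$ For a real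 sequence $(\xi_n)$ with $\xi_n\to0$ and $\sqrt{n/\log n}\,\xi_n\to\infty$, define the moderate deviations constant $$\nu^*:=\liminf_{n\to\infty}-\frac{1}{n\xi_n^2}\log\mathrm{P}_{\mathrm{e},n}\Big(\big\lceil\exp\big(n(R^*(\sigma^2,D)+\xi_n)\big)\big\rceil\Big),$$ denoted $\nu^*_{\mathrm{sp}}$ for the spherical codebook and $\nu^*_{\mathrm{iid}}$ for the i.i.d. Gaussian codebook. Theorem. Suppose in addition that $\log\mathsf{E}[\exp(\theta X^2)]<\infty$ for some $\theta>0$ and that $\mathrm{V}(\sigma^2,\zeta)>0$. Then, for every such sequence $(\xi_n)$, $$\nu^*_{\mathrm{sp}}=\nu^*_{\mathrm{iid}}=\frac{1}{2\mathrm{V}(\sigma^2,\zeta)}.$$ -/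

import Mathlib

open MeasureTheory ProbabilityTheory Filter Topology

noncomputable section

namespace RDSaddle

/-- The quadratic distortion `d(xⁿ, yⁿ) = (1/n) ∑ᵢ (xᵢ - yᵢ)²`. -/
def distortion {n : ℕ} (x y : Fin n → ℝ) : ℝ :=
  (1 / (n : ℝ)) * ∑ i, (x i - y i) ^ 2

/-- The minimum distance encoder of a codebook `c` with `M` codewords: it maps `xⁿ` to the index of
a codeword that minimizes the quadratic distortion (ties are broken arbitrarily). -/
def encoder {n : ℕ} {M : ℕ+} (c : Fin M → Fin n → ℝ) (x : Fin n → ℝ) : Fin M :=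
  Classical.choose (Finite.exists_min fun i => distortion x (c i))

theorem encoder_le {n : ℕ} {M : ℕ+} (c : Fin M → Fin n → ℝ) (x : Fin n → ℝ) (i : Fin M) :
    distortion x (c (encoder c x)) ≤ distortion x (c i) :=
  Classical.choose_spec (Finite.exists_min fun i => distortion x (c i)) i

/-- The decoder of a codebook `c`: it declares the codeword with the received index. -/
def decoder {n : ℕ} {M : ℕ+} (c : Fin M → Fin n → ℝ) (i : Fin M) : Fin n → ℝ := c i

/-- The law of one spherical codeword of length `n` and power `P`: the uniform distribution
(normalized surface measure) on the sphere of radius `√(nP)` centred at the origin of `ℝⁿ`. -/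
def sphericalCodeword (P : ℝ) (n : ℕ) : Measure (Fin n → ℝ) :=
  let S := (volume : Measure (EuclideanSpace ℝ (Fin n))).toSphere
  ((S Set.univ)⁻¹ • S).map fun (u : Metric.sphere (0 : EuclideanSpace ℝ (Fin n)) 1) i =>
    √((n : ℝ) * P) * (u : EuclideanSpace ℝ (Fin n)) i

/-- The law of one i.i.d. Gaussian codeword of length `n` and power `P`: the coordinates are
independent, centred Gaussian with variance `P`. -/
def gaussianCodeword (P : ℝ) (n : ℕ) : Measure (Fin n → ℝ) :=
  Measure.pi fun _ => gaussianReal 0 P.toNNReal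

/-- The ensemble excess-distortion probability at blocklength `n` with `M` codewords and distortion
level `D`. The source sequence has `n` independent coordinates with law `μ`, the `M` codewords are
independent of it and of each other with law `Q`, and the probability is over both. -/
def excessDistortionProb (μ : Measure ℝ) (D : ℝ) {n : ℕ} (Q : Measure (Fin n → ℝ)) (M : ℕ+) :
    ENNReal :=
  ((Measure.pi fun _ : Fin n => μ).prod (Measure.pi fun _ : Fin M => Q))
    {p | D < distortion p.1 (decoder p.2 (encoder p.2 p.1))}

/-- The rate-distortion function `R*(σ², D) = (1/2) log (σ²/D)`, in nats; `s` stands for `σ²`. -/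
def rateDistortion (s D : ℝ) : ℝ := 1 / 2 * Real.log (s / D)

/-- The number of codewords `⌈exp t⌉`. -/
def ceilExp (t : ℝ) : ℕ+ := ⟨⌈Real.exp t⌉₊, Nat.ceil_pos.mpr (Real.exp_pos t)⟩

/-- The moderate deviations constant
`liminf -(1 / (n ξₙ²)) log Pₑₙ(⌈exp (n (R*(σ², D) + ξₙ))⌉)` of the random codebook whose codewords
of length `n` have law `Q n`; `s` stands for `σ²`. It is formed in the extended reals, with
`log 0 = -∞`. -/
def moderateDeviationsConstant (μ : Measure ℝ) (s D : ℝ) (ξ : ℕ → ℝ)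
    (Q : (n : ℕ) → Measure (Fin n → ℝ)) : EReal :=
  liminf (fun n : ℕ =>
    -((1 / ((n : ℝ) * ξ n ^ 2) : ℝ) : EReal) *
      ENNReal.log (excessDistortionProb μ D (Q n)
        (ceilExp ((n : ℝ) * (rateDistortion s D + ξ n))))) atTop

/-- `ν*_sp`: spherical codewords of power `σ² - D`; `s` stands for `σ²`. -/
def nuSpherical (μ : Measure ℝ) (s D : ℝ) (ξ : ℕ → ℝ) : EReal :=
  moderateDeviationsConstant μ s D ξ (sphericalCodeword (s - D))

/-- `ν*_iid`: i.i.d. Gaussian codewords of power `σ² - D`; `s` stands for `σ²`. -/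
def nuGaussian (μ : Measure ℝ) (s D : ℝ) (ξ : ℕ → ℝ) : EReal :=
  moderateDeviationsConstant μ s D ξ (gaussianCodeword (s - D))

/-- The mismatched dispersion `V(σ², ζ) = (ζ - σ⁴) / (4 σ⁴)`; `s` stands for `σ²`. -/
def mismatchedDispersion (s ζ : ℝ) : ℝ := (ζ - s ^ 2) / (4 * s ^ 2)

end RDSaddle

end

/-!
# The moderate deviations constant of random codebooks for the quadratic distortion

Write `s = σ²`, `P = s - D` and `R* = ½ log (s / D)`. Given the source sequence `xⁿ`, the `M`
codewords miss it independently, so the excess-distortion probability is `E[(1 - q(Xⁿ)) ^ M]`, where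
`q(xⁿ)` is the probability that a single codeword is within distortion `D` of `xⁿ`. For both
codebooks `q(xⁿ)` depends only on `z = ‖xⁿ‖² / n`, and near `z = s` its exponent is
`R* + (z - s) / (2 s)` to first order. With `M ≈ exp (n (R* + ξₙ))` codewords the codebook therefore
fails essentially when `z ≥ s + 2 s ξₙ`. This is a moderate deviation of the i.i.d. sum `∑ Xᵢ²`,
whose terms have variance `v = ζ - s²`, and it has probability about
`exp (-n ξₙ² (2 s)² / (2 v)) = exp (-n ξₙ² / (2 V))`. Errors of size `exp (o(n ξₙ))` in `q` are
harmless, because `n ξₙ² → ∞`. The reduction is `moderateDeviationsConstant_eq`.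

* The moderate deviations of `∑ Xᵢ²` are proved in `moderate_deviations_upper` (Chernoff) and
  `moderate_deviations_lower` (exponential tilting and Chebyshev), from the quadratic behaviour of
  the cumulant generating function at `0`.
* The upper bound on `q` for Gaussian codewords, `gaussianCodeword_distortion_le`, is the Chernoff
  bound at the parameter `1 / (2 D)`, which is exactly linear in `z`.
* The lower bound, `eventually_le_gaussianCodeword`, changes measure to `⊗ᵢ 𝓝(m xᵢ, w)`, where `m`
  and `w` are chosen so that the codeword has power `P` and distortion slightly below `D` on
  average; the cost is `½ log (P / w)` per coordinate, bounded in `half_log_div_le`. Under the new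
  measure the codeword has power close to `P` as well, which is what the spherical case needs.
* A spherical codeword is a Gaussian one rescaled to power `P`, and its direction is independent of
  the power of the Gaussian one (`gaussianCodeword_normalize_and_meanSquare`, from polar
  coordinates). Since the power concentrates at `P`, both bounds on `q` carry over
  (`sphericalCodeword_hit`, `sphericalCodeword_miss`).

All comparisons of probabilities rest on one fact, `pi_withDensity_apply_le`: a pointwise bound
between two product densities on an event bounds the probabilities of the event.
-/

noncomputable section

namespace RDSaddle

/-! ### Products of measures with densities -/

theorem lintegral_pi_prod {n : ℕ} {E : Type*} [MeasurableSpace E] (μ : Fin n → Measure E)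
    [∀ i, SigmaFinite (μ i)] (f : Fin n → E → ENNReal) (hf : ∀ i, Measurable (f i)) :
    ∫⁻ x, ∏ i, f i (x i) ∂(Measure.pi μ) = ∏ i, ∫⁻ x, f i x ∂(μ i) := by
  induction n with
  | zero => simp
  | succ n ih =>
    rw [← ((measurePreserving_piFinSuccAbove μ 0).symm).lintegral_comp_emb
      (MeasurableEquiv.measurableEmbedding _)]
    simp_rw [MeasurableEquiv.piFinSuccAbove_symm_apply, Fin.insertNthEquiv,
      Fin.prod_univ_succ, Fin.insertNth_zero, Equiv.coe_fn_mk, Fin.cons_succ,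
      Fin.zero_succAbove, Fin.cons_zero]
    rw [← ih (fun i => μ i.succ) (fun i => f i.succ) (fun i => hf _)]
    exact lintegral_prod_mul (μ := μ 0) (ν := Measure.pi fun i : Fin n => μ i.succ) (f := f 0)
      (g := fun x : Fin n → E => ∏ i, f i.succ (x i)) (hf 0).aemeasurable
      (Finset.measurable_prod _ fun i _ => (hf _).comp (measurable_pi_apply i)).aemeasurable

theorem pi_withDensity {n : ℕ} {E : Type*} [MeasurableSpace E] (μ : Fin n → Measure E)
    [∀ i, SigmaFinite (μ i)] (f : Fin n → E → ENNReal) (hf : ∀ i, Measurable (f i))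
    [∀ i, SigmaFinite ((μ i).withDensity (f i))] :
    Measure.pi (fun i => (μ i).withDensity (f i)) =
      (Measure.pi μ).withDensity (fun x => ∏ i, f i (x i)) := by
  refine Measure.pi_eq fun s hs => ?_
  rw [withDensity_apply _ (MeasurableSet.univ_pi hs),
    ← lintegral_indicator (MeasurableSet.univ_pi hs)]
  have : ∀ x : Fin n → E, (Set.univ.pi s).indicator (fun x => ∏ i, f i (x i)) x
      = ∏ i, (s i).indicator (f i) (x i) := by
    intro x
    by_cases hx : x ∈ Set.univ.pi s
    · rw [Set.indicator_of_mem hx]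
      exact Finset.prod_congr rfl fun i _ => (Set.indicator_of_mem (hx i trivial) _).symm
    · rw [Set.indicator_of_notMem hx]
      simp only [Set.mem_pi, Set.mem_univ, true_imp_iff, not_forall] at hx
      obtain ⟨i, hi⟩ := hx
      exact (Finset.prod_eq_zero (Finset.mem_univ i) (Set.indicator_of_notMem hi _)).symm
  simp_rw [this]
  rw [lintegral_pi_prod μ _ fun i => (hf i).indicator (hs i)]
  exact Finset.prod_congr rfl fun i _ => by
    rw [lintegral_indicator (hs i), withDensity_apply _ (hs i)]

/-- The change of measure that drives every estimate below: a pointwise comparison of two product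
densities on an event compares the probabilities of the event. -/
theorem pi_withDensity_apply_le {n : ℕ} {E : Type*} [MeasurableSpace E] (μ : Fin n → Measure E)
    [∀ i, SigmaFinite (μ i)] (f g : Fin n → E → ENNReal) (hf : ∀ i, Measurable (f i))
    (hg : ∀ i, Measurable (g i)) [∀ i, SigmaFinite ((μ i).withDensity (f i))]
    [∀ i, SigmaFinite ((μ i).withDensity (g i))] {A : Set (Fin n → E)} (hA : MeasurableSet A)
    (C : ENNReal) (h : ∀ x ∈ A, ∏ i, f i (x i) ≤ C * ∏ i, g i (x i)) :
    Measure.pi (fun i => (μ i).withDensity (f i)) A ≤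
      C * Measure.pi (fun i => (μ i).withDensity (g i)) A := by
  have hm : Measurable fun x : Fin n → E => ∏ i, g i (x i) :=
    Finset.measurable_prod _ fun i _ => (hg _).comp (measurable_pi_apply i)
  rw [pi_withDensity μ f hf, pi_withDensity μ g hg, withDensity_apply _ hA, withDensity_apply _ hA,
    ← lintegral_const_mul _ hm]
  exact setLIntegral_mono' hA h

/-- Chebyshev's inequality for a sum of independent centred variables. -/
theorem pi_abs_sum_ge_le {n : ℕ} {E : Type*} [MeasurableSpace E] (μ : Fin n → Measure E)
    [∀ i, IsProbabilityMeasure (μ i)] (X : Fin n → E → ℝ) (hX : ∀ i, MemLp (X i) 2 (μ i))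
    (h0 : ∀ i, ∫ x, X i x ∂(μ i) = 0) {c : ℝ} (hc : 0 < c) :
    Measure.pi μ {x | c ≤ |∑ i, X i (x i)|} ≤ ENNReal.ofReal ((∑ i, Var[X i; μ i]) / c ^ 2) := by
  have hL : ∀ i, MemLp (fun x : Fin n → E => X i (x i)) 2 (Measure.pi μ) := fun i =>
    (hX i).comp_measurePreserving (measurePreserving_eval _ i)
  have h := meas_ge_le_variance_div_sq (μ := Measure.pi μ) (X := ∑ i, fun x => X i (x i))
    (memLp_finsetSum' _ fun i _ => hL i) hc
  rw [variance_sum_pi hX] at h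
  have hmean : ∫ x, (∑ i, fun x : Fin n → E => X i (x i)) x ∂(Measure.pi μ) = 0 := by
    simp only [Finset.sum_apply]
    rw [integral_finsetSum _ fun i _ => (hL i).integrable (by norm_num)]
    refine Finset.sum_eq_zero fun i _ => ?_
    rw [← h0 i]
    exact integral_comp_eval (μ := μ) (i := i) (f := X i) (hX i).aestronglyMeasurable
  simp only [hmean, sub_zero] at h
  simpa using h

/-! ### Moderate deviations of i.i.d. sums -/

section ModerateDeviations

theorem half_le_of_compl_le {Ω : Type*} [MeasurableSpace Ω] {μ : Measure Ω}
    [IsProbabilityMeasure μ] {A : Set Ω} (hA : MeasurableSet A)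
    (h : μ Aᶜ ≤ ENNReal.ofReal (1 / 2)) : ENNReal.ofReal (1 / 2) ≤ μ A := by
  rw [prob_compl_eq_one_sub hA, tsub_le_iff_right] at h
  have h2 : ENNReal.ofReal (1 / 2) + ENNReal.ofReal (1 / 2) = 1 := by
    rw [← ENNReal.ofReal_add (by norm_num) (by norm_num)]; norm_num
  rw [← h2] at h
  exact (ENNReal.add_le_add_iff_left ENNReal.ofReal_ne_top).mp h

theorem prod_ofReal_exp_sub {Ω : Type*} {W : Ω → ℝ} {n : ℕ} (t c : ℝ) (x : Fin n → Ω) :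
    ∏ i, ENNReal.ofReal (Real.exp (t * W (x i) - c)) =
      ENNReal.ofReal (Real.exp (t * ∑ i, W (x i) - n * c)) := by
  rw [← ENNReal.ofReal_prod_of_nonneg fun i _ => (Real.exp_pos _).le, ← Real.exp_sum]
  simp [Finset.sum_sub_distrib, Finset.mul_sum]

/-- The exponent of the tilted lower bound at a tilt `t = (a + κ) x / v`, when the cumulant
generating function is at least `w`. -/
theorem tilted_exponent_le {a κ η v x t w N : ℝ} (ha : 0 < a) (hκ : 0 < κ) (hκ1 : κ ≤ 1)
    (hκ2 : (4 * a + 3) * κ ≤ η * v / 2) (hv : 0 < v) (hN : 0 < N) (ht : t = (a + κ) * x / v)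
    (hw : v / 2 * t ^ 2 - η * v ^ 2 / (4 * (a + κ) ^ 2) * t ^ 2 ≤ w) :
    t * (N * x * (a + 2 * κ)) - N * w ≤ N * x ^ 2 * (a ^ 2 / (2 * v) + η / 2) := by
  have h1' := mul_le_mul_of_nonneg_left hw hN.le
  have e1 : η * v ^ 2 / (4 * (a + κ) ^ 2) * t ^ 2 = η / 4 * x ^ 2 := by rw [ht]; field_simp
  have e2 : t * (N * x * (a + 2 * κ)) - N * (v / 2 * t ^ 2) =
      N * x ^ 2 * ((a ^ 2 + (4 * a + 3 * κ) * κ) / (2 * v)) := by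
    rw [ht]; field_simp; ring
  have e3 : (a ^ 2 + (4 * a + 3 * κ) * κ) / (2 * v) ≤ a ^ 2 / (2 * v) + η / 4 := by
    rw [add_div]
    have h5 : (4 * a + 3 * κ) * κ ≤ (4 * a + 3) * κ := by gcongr; linarith
    have : (4 * a + 3 * κ) * κ / (2 * v) ≤ η / 4 := by
      rw [div_le_iff₀ (by positivity)]
      linarith
    linarith
  have e4 := mul_le_mul_of_nonneg_left e3 (by positivity : 0 ≤ N * x ^ 2)
  rw [e1] at h1'
  linarith

variable {Ω : Type*} [MeasurableSpace Ω] {μ : Measure Ω} [IsProbabilityMeasure μ] {W : Ω → ℝ}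

theorem tilted_eq_withDensity_cgf {t : ℝ} (ht : Integrable (fun x => Real.exp (t * W x)) μ) :
    μ.tilted (fun x => t * W x) =
      μ.withDensity fun x => ENNReal.ofReal (Real.exp (t * W x - cgf W μ t)) := by
  rw [Measure.tilted]
  congr with x
  rw [Real.exp_sub, exp_cgf ht, mgf]

theorem chernoff_pi (hW : Measurable W) {t : ℝ} (ht : Integrable (fun x => Real.exp (t * W x)) μ)
    (n : ℕ) (b : ℝ) :
    Measure.pi (fun _ : Fin n => μ) {x | b ≤ t * ∑ i, W (x i)} ≤
      ENNReal.ofReal (Real.exp (n * cgf W μ t - b)) := by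
  have hA : MeasurableSet {x : Fin n → Ω | b ≤ t * ∑ i, W (x i)} :=
    measurableSet_le (by fun_prop) (by fun_prop)
  have hprob := isProbabilityMeasure_tilted ht
  rw [tilted_eq_withDensity_cgf ht] at hprob
  have : IsProbabilityMeasure (μ.withDensity fun _ => 1) := by simpa using ‹IsProbabilityMeasure μ›
  have h := pi_withDensity_apply_le (fun _ : Fin n => μ) (fun _ _ => 1)
    (fun _ x => ENNReal.ofReal (Real.exp (t * W x - cgf W μ t))) (fun _ => measurable_const)
    (fun _ => by fun_prop) hA (ENNReal.ofReal (Real.exp (n * cgf W μ t - b))) (by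
      intro x hx
      rw [prod_ofReal_exp_sub, ← ENNReal.ofReal_mul (Real.exp_pos _).le, ← Real.exp_add]
      simp only [Finset.prod_const_one, ENNReal.one_le_ofReal, Real.one_le_exp_iff]
      have : b ≤ t * ∑ i, W (x i) := hx
      linarith)
  have h1 : (μ.withDensity fun _ => 1) = μ := withDensity_one
  rw [h1] at h
  exact h.trans (mul_le_of_le_one_right' prob_le_one)

/-- The converse change of measure: the tilted law does not exceed the original one by more than
`exp (b - n cgf t)` on events where `t ∑ W ≤ b`. -/
theorem tilted_pi_le (hW : Measurable W) {t : ℝ} (ht : Integrable (fun x => Real.exp (t * W x)) μ)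
    {n : ℕ} {A : Set (Fin n → Ω)} (hA : MeasurableSet A) (b : ℝ)
    (hb : ∀ x ∈ A, t * ∑ i, W (x i) ≤ b) :
    Measure.pi (fun _ : Fin n => μ.tilted fun x => t * W x) A ≤
      ENNReal.ofReal (Real.exp (b - n * cgf W μ t)) * Measure.pi (fun _ : Fin n => μ) A := by
  have hprob := isProbabilityMeasure_tilted ht
  rw [tilted_eq_withDensity_cgf ht] at hprob ⊢
  have : IsProbabilityMeasure (μ.withDensity fun _ => 1) := by simpa using ‹IsProbabilityMeasure μ›
  have h := pi_withDensity_apply_le (fun _ : Fin n => μ)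
    (fun _ x => ENNReal.ofReal (Real.exp (t * W x - cgf W μ t))) (fun _ _ => 1)
    (fun _ => by fun_prop) (fun _ => measurable_const)
    hA (ENNReal.ofReal (Real.exp (b - n * cgf W μ t))) (by
      intro x hx
      rw [prod_ofReal_exp_sub, Finset.prod_const_one, mul_one]
      exact ENNReal.ofReal_le_ofReal (Real.exp_le_exp.mpr (by linarith [hb x hx])))
  have h1 : (μ.withDensity fun _ => 1) = μ := withDensity_one
  rwa [h1] at h

theorem eventually_abs_deriv_cgf_sub_le (h0 : 0 ∈ interior (integrableExpSet W μ))
    (hmean : ∫ x, W x ∂μ = 0) {η : ℝ} (hη : 0 < η) :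
    ∀ᶠ t in 𝓝 (0 : ℝ), |deriv (cgf W μ) t - Var[W; μ] * t| ≤ η * |t| := by
  have hd : HasDerivAt (deriv (cgf W μ)) (Var[W; μ]) 0 := by
    have h := (analyticAt_cgf h0).deriv.differentiableAt.hasDerivAt
    have hv := variance_tilted_mul h0
    rw [iteratedDeriv_succ, iteratedDeriv_one] at hv
    rw [← hv] at h
    simpa using h
  have h := (hasDerivAt_iff_isLittleO.mp hd).def hη
  simpa [deriv_cgf_zero h0, hmean, mul_comm] using h

theorem eventually_abs_cgf_sub_le (h0 : 0 ∈ interior (integrableExpSet W μ))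
    (hmean : ∫ x, W x ∂μ = 0) {η : ℝ} (hη : 0 < η) :
    ∀ᶠ t in 𝓝 (0 : ℝ), |cgf W μ t - Var[W; μ] / 2 * t ^ 2| ≤ η * t ^ 2 := by
  have hev := (isOpen_interior.eventually_mem h0).and (eventually_abs_deriv_cgf_sub_le h0 hmean hη)
  obtain ⟨r, hr, hball⟩ := Metric.eventually_nhds_iff_ball.mp hev
  filter_upwards [Metric.ball_mem_nhds (0 : ℝ) hr] with t ht
  have hsub : ∀ y ∈ Metric.closedBall (0 : ℝ) |t|, y ∈ Metric.ball (0 : ℝ) r := fun y hy => by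
    simp only [Metric.mem_closedBall, Metric.mem_ball, dist_zero_right, Real.norm_eq_abs] at *
    exact hy.trans_lt ht
  have h := (convex_closedBall (0 : ℝ) |t|).norm_image_sub_le_of_norm_hasDerivWithin_le
    (f := fun y => cgf W μ y - Var[W; μ] / 2 * y ^ 2)
    (f' := fun y => deriv (cgf W μ) y - Var[W; μ] * y) (C := η * |t|) (x := 0) (y := t)
    (fun y hy => by
      have h1 := (analyticAt_cgf (hball y (hsub y hy)).1).differentiableAt.hasDerivAt
      have h2 := ((hasDerivAt_pow 2 y).const_mul (Var[W; μ] / 2))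
      refine (h1.sub h2).hasDerivWithinAt.congr_deriv ?_
      norm_num; ring)
    (fun y hy => by
      refine (hball y (hsub y hy)).2.trans ?_
      simp only [Metric.mem_closedBall, dist_zero_right, Real.norm_eq_abs] at hy
      gcongr)
    (by simp) (by simp)
  simp only [cgf_zero, sub_zero, Real.norm_eq_abs] at h
  calc |cgf W μ t - Var[W; μ] / 2 * t ^ 2| ≤ η * |t| * |t| := by simpa using h
    _ = η * t ^ 2 := by rw [mul_assoc, ← sq, sq_abs]

/-- The upper bound on both tails at once: for `a > 0` the event is `∑ W ≥ n a ξₙ`, for `a < 0` it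
is `∑ W ≤ n a ξₙ`. -/
theorem moderate_deviations_upper (hW : Measurable W) (h0 : 0 ∈ interior (integrableExpSet W μ))
    (hmean : ∫ x, W x ∂μ = 0) (hv : 0 < Var[W; μ]) {ξ : ℕ → ℝ} (hξ : Tendsto ξ atTop (𝓝 0))
    (hpos : ∀ᶠ n in atTop, 0 < ξ n) (a : ℝ) {η : ℝ} (hη : 0 < η) :
    ∀ᶠ n : ℕ in atTop, Measure.pi (fun _ : Fin n => μ) {x | n * ξ n * a ^ 2 ≤ a * ∑ i, W (x i)} ≤
      ENNReal.ofReal (Real.exp (-(n * ξ n ^ 2 * (a ^ 2 / (2 * Var[W; μ]) - η)))) := by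
  set v := Var[W; μ] with hvdef
  have hη' : 0 < η * v ^ 2 / (a ^ 2 + 1) := by positivity
  have ht : Tendsto (fun n => a * ξ n / v) atTop (𝓝 0) := by
    simpa using (hξ.const_mul a).div_const v
  filter_upwards [ht.eventually (eventually_abs_cgf_sub_le h0 hmean hη'),
    ht.eventually (isOpen_interior.eventually_mem h0), hpos] with n hcgf hint hn
  have hsub : {x : Fin n → Ω | n * ξ n * a ^ 2 ≤ a * ∑ i, W (x i)} ⊆
      {x | n * ξ n ^ 2 * a ^ 2 / v ≤ (a * ξ n / v) * ∑ i, W (x i)} := by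
    intro x hx
    simp only [Set.mem_ofPred_eq] at hx ⊢
    have := mul_le_mul_of_nonneg_left hx (div_pos hn hv).le
    calc n * ξ n ^ 2 * a ^ 2 / v = ξ n / v * (n * ξ n * a ^ 2) := by ring
      _ ≤ _ := this
      _ = _ := by ring
  refine (measure_mono hsub).trans ((chernoff_pi hW
    (interior_subset (s := integrableExpSet W μ) hint) n _).trans ?_)
  refine ENNReal.ofReal_le_ofReal (Real.exp_le_exp.mpr ?_)
  have h1 : cgf W μ (a * ξ n / v) ≤
      v / 2 * (a * ξ n / v) ^ 2 + η * v ^ 2 / (a ^ 2 + 1) * (a * ξ n / v) ^ 2 := by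
    linarith [(abs_le.mp hcgf).2]
  have h2 : η * v ^ 2 / (a ^ 2 + 1) * (a * ξ n / v) ^ 2 ≤ η * ξ n ^ 2 := by
    rw [show η * v ^ 2 / (a ^ 2 + 1) * (a * ξ n / v) ^ 2
      = (η * ξ n ^ 2) * (a ^ 2 / (a ^ 2 + 1)) by field_simp]
    exact mul_le_of_le_one_right (by positivity) (by rw [div_le_one (by positivity)]; linarith)
  have h3 := mul_le_mul_of_nonneg_left (h1.trans (add_le_add_right h2 _))
    (Nat.cast_nonneg (α := ℝ) n)
  calc n * cgf W μ (a * ξ n / v) - n * ξ n ^ 2 * a ^ 2 / v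
      ≤ n * (v / 2 * (a * ξ n / v) ^ 2 + η * ξ n ^ 2) - n * ξ n ^ 2 * a ^ 2 / v := by linarith
    _ = _ := by field_simp; ring

/-- Under the tilt of parameter `(a + κ) ξₙ / v` the sum concentrates slightly above `n a ξₙ`. -/
theorem moderate_deviations_lower (hW : Measurable W) (h0 : 0 ∈ interior (integrableExpSet W μ))
    (hmean : ∫ x, W x ∂μ = 0) (hv : 0 < Var[W; μ]) {ξ : ℕ → ℝ} (hξ : Tendsto ξ atTop (𝓝 0))
    (hpos : ∀ᶠ n in atTop, 0 < ξ n) (hinf : Tendsto (fun n : ℕ => n * ξ n ^ 2) atTop atTop)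
    {a : ℝ} (ha : 0 < a) {η : ℝ} (hη : 0 < η) :
    ∀ᶠ n : ℕ in atTop,
      ENNReal.ofReal (Real.exp (-(n * ξ n ^ 2 * (a ^ 2 / (2 * Var[W; μ]) + η)))) ≤
      Measure.pi (fun _ : Fin n => μ) {x | n * ξ n * a ≤ ∑ i, W (x i)} := by
  set v := Var[W; μ] with hvdef
  obtain ⟨κ, hκ, hκ1, hκ2⟩ : ∃ κ : ℝ, 0 < κ ∧ κ ≤ 1 ∧ (4 * a + 3) * κ ≤ η * v / 2 := by
    refine ⟨min 1 (η * v / 2 / (4 * a + 3)), by positivity, min_le_left _ _, ?_⟩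
    calc (4 * a + 3) * min 1 (η * v / 2 / (4 * a + 3))
        ≤ (4 * a + 3) * (η * v / 2 / (4 * a + 3)) := by gcongr; exact min_le_right _ _
      _ = _ := by field_simp
  set η' := η * v ^ 2 / (4 * (a + κ) ^ 2) with hη'def
  have hη' : 0 < η' := by positivity
  have hη2 : 0 < κ * v / (2 * (a + κ)) := by positivity
  have ht : Tendsto (fun n => (a + κ) * ξ n / v) atTop (𝓝 0) := by
    simpa using (hξ.const_mul (a + κ)).div_const v
  have hvar : ∀ᶠ t in 𝓝 (0 : ℝ), iteratedDeriv 2 (cgf W μ) t < 2 * v := by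
    have hc : ContinuousAt (iteratedDeriv 2 (cgf W μ)) 0 := by
      rw [iteratedDeriv_eq_iterate]
      exact ((analyticAt_cgf h0).iterated_deriv 2).continuousAt
    refine hc.eventually_lt continuousAt_const ?_
    have hv0 := variance_tilted_mul h0
    rw [← hv0]
    simp only [zero_mul]
    have : μ.tilted (fun _ => (0 : ℝ)) = μ := by simp
    rw [this]; linarith
  filter_upwards [ht.eventually (eventually_abs_cgf_sub_le h0 hmean hη'),
    ht.eventually (eventually_abs_deriv_cgf_sub_le h0 hmean hη2), ht.eventually hvar,
    ht.eventually (isOpen_interior.eventually_mem h0), hpos,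
    hinf.eventually_ge_atTop (16 * v / κ ^ 2), hinf.eventually_ge_atTop (2 * Real.log 2 / η)]
    with n hcgf hder hvar hint hn hbig hbig2
  set t := (a + κ) * ξ n / v with htdef
  have htpos : 0 < t := by positivity
  have hn0 : (0 : ℝ) < n := by
    by_contra hcon
    have : (n : ℝ) = 0 := le_antisymm (not_lt.mp hcon) (Nat.cast_nonneg n)
    rw [this, zero_mul] at hbig
    have : 0 < 16 * v / κ ^ 2 := by positivity
    linarith
  have htint := interior_subset (s := integrableExpSet W μ) hint
  set ν := μ.tilted (fun x => t * W x) with hν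
  have : IsProbabilityMeasure ν := isProbabilityMeasure_tilted htint
  set m := deriv (cgf W μ) t with hm
  have hmean' : |m - (a + κ) * ξ n| ≤ κ * ξ n / 2 := by
    have e1 : v * t = (a + κ) * ξ n := by rw [htdef]; field_simp
    have e2 : κ * v / (2 * (a + κ)) * |t| = κ * ξ n / 2 := by
      rw [abs_of_pos htpos, htdef]; field_simp
    rwa [e1, e2] at hder
  have hLp : MemLp W 2 ν := by simpa using memLp_tilted_mul hint 2
  set c := n * (κ * ξ n / 2) with hc
  have hcpos : 0 < c := by positivity
  have hcheb := pi_abs_sum_ge_le (fun _ : Fin n => ν) (fun _ x => W x - m)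
    (fun _ => hLp.sub (memLp_const m)) (fun _ => by
      rw [integral_sub (hLp.integrable (by norm_num)) (integrable_const _)]
      have := integral_tilted_mul_self hint
      simp [hν, this, hm]) hcpos
  have hV : Var[fun x => W x - m; ν] ≤ 2 * v := by
    rw [variance_sub_const hLp.aestronglyMeasurable, hν, variance_tilted_mul hint]
    exact hvar.le
  have hhalf : (∑ _i : Fin n, Var[fun x => W x - m; ν]) / c ^ 2 ≤ 1 / 2 := by
    rw [div_le_iff₀ (by positivity)]
    rw [div_le_iff₀ (by positivity)] at hbig
    simp only [Finset.sum_const, Finset.card_univ, Fintype.card_fin, nsmul_eq_mul]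
    calc (n : ℝ) * Var[fun x => W x - m; ν] ≤ n * (2 * v) := by gcongr
      _ = n / 8 * (16 * v) := by ring
      _ ≤ n / 8 * (n * ξ n ^ 2 * κ ^ 2) := by gcongr
      _ = 1 / 2 * c ^ 2 := by rw [hc]; ring
  set A : Set (Fin n → Ω) := {x | |∑ i, (W (x i) - m)| < c} with hAdef
  have hA : MeasurableSet A := measurableSet_lt (by fun_prop) (by fun_prop)
  have hAc : Aᶜ = {x | c ≤ |∑ i, (W (x i) - m)|} := by
    ext x; simp [hAdef]
  have hνA : ENNReal.ofReal (1 / 2) ≤ Measure.pi (fun _ : Fin n => ν) A := by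
    refine half_le_of_compl_le hA ?_
    rw [hAc]
    exact hcheb.trans (ENNReal.ofReal_le_ofReal hhalf)
  have hAsum : ∀ x ∈ A, n * ξ n * a ≤ ∑ i, W (x i) ∧
      ∑ i, W (x i) ≤ n * ξ n * (a + 2 * κ) := by
    intro x hx
    have hx' : |∑ i, (W (x i) - m)| < c := hx
    simp only [Finset.sum_sub_distrib, Finset.sum_const, Finset.card_univ, Fintype.card_fin,
      nsmul_eq_mul] at hx'
    obtain ⟨l1, l2⟩ := abs_lt.mp hx'
    obtain ⟨k1, k2⟩ := abs_le.mp hmean'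
    have k1' := mul_le_mul_of_nonneg_left k1 hn0.le
    have k2' := mul_le_mul_of_nonneg_left k2 hn0.le
    constructor <;> linarith
  have htilt := tilted_pi_le hW htint hA (t * (n * ξ n * (a + 2 * κ))) fun x hx =>
    mul_le_mul_of_nonneg_left (hAsum x hx).2 htpos.le
  set L := t * (n * ξ n * (a + 2 * κ)) - n * cgf W μ t with hL
  have hLle : L ≤ n * ξ n ^ 2 * (a ^ 2 / (2 * v) + η / 2) := by
    refine tilted_exponent_le ha hκ hκ1 hκ2 hv hn0 htdef ?_
    linarith [(abs_le.mp hcgf).1]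
  have hkey : ENNReal.ofReal (1 / 2) ≤
      ENNReal.ofReal (Real.exp L) * Measure.pi (fun _ : Fin n => μ) A := hνA.trans htilt
  refine le_trans ?_ (measure_mono (s := A) fun x hx => (hAsum x hx).1)
  calc ENNReal.ofReal (Real.exp (-(n * ξ n ^ 2 * (a ^ 2 / (2 * v) + η))))
      ≤ ENNReal.ofReal (Real.exp (-L)) * ENNReal.ofReal (1 / 2) := by
        rw [← ENNReal.ofReal_mul (Real.exp_pos _).le]
        refine ENNReal.ofReal_le_ofReal ?_
        rw [show (1 / 2 : ℝ) = Real.exp (-Real.log 2) by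
          rw [Real.exp_neg, Real.exp_log (by norm_num)]; norm_num, ← Real.exp_add]
        refine Real.exp_le_exp.mpr ?_
        rw [div_le_iff₀ hη] at hbig2
        linarith
    _ ≤ ENNReal.ofReal (Real.exp (-L)) *
        (ENNReal.ofReal (Real.exp L) * Measure.pi (fun _ : Fin n => μ) A) := by gcongr
    _ = Measure.pi (fun _ : Fin n => μ) A := by
        rw [← mul_assoc, ← ENNReal.ofReal_mul (Real.exp_pos _).le, ← Real.exp_add]
        simp

end ModerateDeviations

/-! ### The excess-distortion probability of a random codebook -/

/-- The empirical second moment `‖xⁿ‖² / n` of a sequence. -/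
def meanSquare {n : ℕ} (x : Fin n → ℝ) : ℝ := (1 / (n : ℝ)) * ∑ i, x i ^ 2

theorem measurable_meanSquare {n : ℕ} : Measurable (meanSquare : (Fin n → ℝ) → ℝ) := by
  unfold meanSquare; fun_prop

theorem measurableSet_distortion_le {n : ℕ} (x : Fin n → ℝ) (D : ℝ) :
    MeasurableSet {y : Fin n → ℝ | distortion x y ≤ D} := by
  have : Measurable fun y : Fin n → ℝ => distortion x y := by unfold distortion; fun_prop
  exact measurableSet_le this measurable_const

theorem lt_distortion_encoder_iff {n : ℕ} {M : ℕ+} (c : Fin M → Fin n → ℝ) (x : Fin n → ℝ)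
    (D : ℝ) : D < distortion x (decoder c (encoder c x)) ↔ ∀ i, D < distortion x (c i) :=
  ⟨fun h i => h.trans_le (encoder_le c x i), fun h => h _⟩

/-- Given the source sequence, the codewords miss it independently. -/
theorem excessDistortionProb_eq_lintegral (μ : Measure ℝ) [IsProbabilityMeasure μ] (D : ℝ) {n : ℕ}
    (Q : Measure (Fin n → ℝ)) [IsProbabilityMeasure Q] (M : ℕ+) :
    excessDistortionProb μ D Q M =
      ∫⁻ x, (1 - Q {y | distortion x y ≤ D}) ^ (M : ℕ) ∂(Measure.pi fun _ : Fin n => μ) := by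
  have hset : {p : (Fin n → ℝ) × (Fin M → Fin n → ℝ) |
      D < distortion p.1 (decoder p.2 (encoder p.2 p.1))} =
      {p | ∀ i, D < distortion p.1 (p.2 i)} := by
    ext p; exact lt_distortion_encoder_iff _ _ _
  have hmeas : MeasurableSet {p : (Fin n → ℝ) × (Fin M → Fin n → ℝ) |
      ∀ i, D < distortion p.1 (p.2 i)} := by
    have : {p : (Fin n → ℝ) × (Fin M → Fin n → ℝ) | ∀ i, D < distortion p.1 (p.2 i)} =
        ⋂ i, {p | D < distortion p.1 (p.2 i)} := by ext; simp
    rw [this]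
    refine MeasurableSet.iInter fun i => ?_
    have hi : Measurable fun p : (Fin n → ℝ) × (Fin M → Fin n → ℝ) =>
        distortion p.1 (p.2 i) := by
      unfold distortion
      fun_prop
    exact measurableSet_lt measurable_const hi
  rw [excessDistortionProb, hset, Measure.prod_apply hmeas]
  refine lintegral_congr fun x => ?_
  have : Prod.mk x ⁻¹' {p : (Fin n → ℝ) × (Fin M → Fin n → ℝ) | ∀ i, D < distortion p.1 (p.2 i)} =
      Set.univ.pi fun _ => {y | distortion x y ≤ D}ᶜ := by
    ext c; simp
  rw [this, Measure.pi_pi, prob_compl_eq_one_sub (measurableSet_distortion_le x D)]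
  simp

theorem exp_le_ceilExp (t : ℝ) : Real.exp t ≤ ((ceilExp t : ℕ) : ℝ) := Nat.le_ceil _

theorem ceilExp_le {t : ℝ} (ht : 0 ≤ t) : ((ceilExp t : ℕ) : ℝ) ≤ 2 * Real.exp t := by
  have h := (Nat.ceil_lt_add_one (Real.exp_pos t).le).le
  have h1 := Real.one_le_exp ht
  change ((⌈Real.exp t⌉₊ : ℕ) : ℝ) ≤ _
  linarith

/-- If each codeword hits with probability at least `exp (-(t - y))`, then `⌈exp t⌉` independent
codewords all miss with probability at most `exp (-exp y)`, of which `exp (-y)` is kept. -/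
theorem one_sub_pow_ceilExp_le {q : ENNReal} {t y : ℝ}
    (h : ENNReal.ofReal (Real.exp (-(t - y))) ≤ q) :
    (1 - q) ^ (ceilExp t : ℕ) ≤ ENNReal.ofReal (Real.exp (-y)) := by
  set L := Real.exp (-(t - y)) with hL
  have h1 : 1 - q ≤ ENNReal.ofReal (Real.exp (-L)) := by
    calc 1 - q ≤ 1 - ENNReal.ofReal L := tsub_le_tsub_left h 1
      _ = ENNReal.ofReal (1 - L) := by
        rw [ENNReal.ofReal_sub _ (Real.exp_pos _).le, ENNReal.ofReal_one]
      _ ≤ _ := ENNReal.ofReal_le_ofReal (Real.one_sub_le_exp_neg L)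
  refine (pow_le_pow_left' h1 _).trans ?_
  rw [← ENNReal.ofReal_pow (Real.exp_pos _).le, ← Real.exp_nat_mul]
  refine ENNReal.ofReal_le_ofReal (Real.exp_le_exp.mpr ?_)
  have h2 : Real.exp t * L = Real.exp y := by rw [hL, ← Real.exp_add]; congr 1; ring
  have h3 := mul_le_mul_of_nonneg_right (exp_le_ceilExp t) (Real.exp_pos (-(t - y))).le
  rw [← hL, h2] at h3
  have h4 := Real.add_one_le_exp y
  linarith

/-- If each codeword hits with probability at most `exp (-(t + y))`, then with probability at least
`1/2` all of `⌈exp t⌉` independent codewords miss. -/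
theorem half_le_one_sub_pow_ceilExp {q : ENNReal} {t y : ℝ} (ht : 0 ≤ t) (hy : Real.log 4 ≤ y)
    (h : q ≤ ENNReal.ofReal (Real.exp (-(t + y)))) :
    ENNReal.ofReal (1 / 2) ≤ (1 - q) ^ (ceilExp t : ℕ) := by
  set u := Real.exp (-(t + y)) with hu
  have hy0 : 0 ≤ y := (Real.log_nonneg (by norm_num)).trans hy
  have hu1 : u ≤ 1 := Real.exp_le_one_iff.mpr (by linarith)
  have h1 : ENNReal.ofReal (1 - u) ≤ 1 - q := by
    rw [ENNReal.ofReal_sub _ (Real.exp_pos _).le, ENNReal.ofReal_one]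
    exact tsub_le_tsub_left h 1
  refine le_trans ?_ (pow_le_pow_left' h1 _)
  rw [← ENNReal.ofReal_pow (by linarith)]
  refine ENNReal.ofReal_le_ofReal ?_
  have h2 := one_add_mul_le_pow (a := -u) (by linarith) (ceilExp t : ℕ)
  rw [← sub_eq_add_neg] at h2
  have h3 := mul_le_mul_of_nonneg_right (ceilExp_le ht) (Real.exp_pos (-(t + y))).le
  have h4 : 2 * Real.exp t * u = 2 * Real.exp (-y) := by
    rw [hu, mul_assoc, ← Real.exp_add]; congr 2; ring
  have h5 : Real.exp (-y) ≤ 1 / 4 := by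
    rw [show (1 / 4 : ℝ) = Real.exp (-Real.log 4) by
      rw [Real.exp_neg, Real.exp_log (by norm_num)]; norm_num]
    exact Real.exp_le_exp.mpr (by linarith)
  rw [← hu, h4] at h3
  linarith

/-- Achievability: the codebook fails with probability at most `exp (-y)` unless the source sequence
leaves a set `G` on which single codewords hit often enough. -/
theorem excessDistortionProb_le {μ : Measure ℝ} [IsProbabilityMeasure μ] {D : ℝ} {n : ℕ}
    {Q : Measure (Fin n → ℝ)} [IsProbabilityMeasure Q] {t y : ℝ} {G : Set (Fin n → ℝ)}
    (hG : MeasurableSet G)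
    (h : ∀ x ∈ G, ENNReal.ofReal (Real.exp (-(t - y))) ≤ Q {z | distortion x z ≤ D}) :
    excessDistortionProb μ D Q (ceilExp t) ≤
      Measure.pi (fun _ : Fin n => μ) Gᶜ + ENNReal.ofReal (Real.exp (-y)) := by
  rw [excessDistortionProb_eq_lintegral]
  calc _ ≤ ∫⁻ x, (Gᶜ.indicator 1 x + ENNReal.ofReal (Real.exp (-y)))
        ∂(Measure.pi fun _ : Fin n => μ) := by
        refine lintegral_mono fun x => ?_
        by_cases hx : x ∈ G
        · simpa [hx] using one_sub_pow_ceilExp_le (h x hx)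
        · simp only [Set.mem_compl_iff, hx, not_false_eq_true, Set.indicator_of_mem, Pi.one_apply]
          exact (pow_le_one' tsub_le_self _).trans le_self_add
    _ = _ := by
        rw [lintegral_add_right _ measurable_const, lintegral_indicator_one hG.compl]
        simp

/-- Converse: the codebook fails with probability at least `1/2` on a set `G` of source sequences
which single codewords hit too rarely. -/
theorem le_excessDistortionProb {μ : Measure ℝ} [IsProbabilityMeasure μ] {D : ℝ} {n : ℕ}
    {Q : Measure (Fin n → ℝ)} [IsProbabilityMeasure Q] {t y : ℝ} (ht : 0 ≤ t)
    (hy : Real.log 4 ≤ y) {G : Set (Fin n → ℝ)} (hG : MeasurableSet G)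
    (h : ∀ x ∈ G, Q {z | distortion x z ≤ D} ≤ ENNReal.ofReal (Real.exp (-(t + y)))) :
    ENNReal.ofReal (1 / 2) * Measure.pi (fun _ : Fin n => μ) G ≤
      excessDistortionProb μ D Q (ceilExp t) := by
  rw [excessDistortionProb_eq_lintegral, ← setLIntegral_const]
  calc _ ≤ ∫⁻ x in G, (1 - Q {y | distortion x y ≤ D}) ^ (ceilExp t : ℕ)
        ∂(Measure.pi fun _ : Fin n => μ) :=
        setLIntegral_mono' hG fun x hx => half_le_one_sub_pow_ceilExp ht hy (h x hx)
    _ ≤ _ := setLIntegral_le_lintegral _ _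

/-! ### From single-codeword hitting probabilities to the moderate deviations constant -/

theorem tendsto_mul_sq_of_moderate {ξ : ℕ → ℝ}
    (hξ' : Tendsto (fun n : ℕ => √((n : ℝ) / Real.log n) * ξ n) atTop atTop) :
    Tendsto (fun n : ℕ => (n : ℝ) * ξ n ^ 2) atTop atTop := by
  have h2 := hξ'.atTop_mul_atTop₀ hξ'
  have hlog : ∀ᶠ n : ℕ in atTop, 1 ≤ Real.log n :=
    (Real.tendsto_log_atTop.comp tendsto_natCast_atTop_atTop).eventually_ge_atTop 1
  refine tendsto_atTop_mono' _ ?_ h2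
  filter_upwards [hlog] with n hn
  have h0 : (0 : ℝ) ≤ n / Real.log n := by positivity
  calc √((n : ℝ) / Real.log n) * ξ n * (√((n : ℝ) / Real.log n) * ξ n)
      = (√((n : ℝ) / Real.log n) * √((n : ℝ) / Real.log n)) * ξ n ^ 2 := by ring
    _ = (n : ℝ) / Real.log n * ξ n ^ 2 := by rw [Real.mul_self_sqrt h0]
    _ ≤ n * ξ n ^ 2 := by
      gcongr
      exact div_le_self (Nat.cast_nonneg n) hn

theorem eventually_pos_of_moderate {ξ : ℕ → ℝ}
    (hξ' : Tendsto (fun n : ℕ => √((n : ℝ) / Real.log n) * ξ n) atTop atTop) :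
    ∀ᶠ n in atTop, 0 < ξ n := by
  filter_upwards [hξ'.eventually_gt_atTop 0] with n hn
  exact pos_of_mul_pos_right hn (Real.sqrt_nonneg _)

/-- Two-sided exponential bounds on `p n` determine the `liminf`, in fact the limit, of its
normalized logarithm in the extended reals. -/
theorem liminf_neg_mul_log_eq {a : ℕ → ℝ} {p : ℕ → ENNReal} {c : ℝ} (ha : ∀ᶠ n in atTop, 0 < a n)
    (hup : ∀ η > 0, ∀ᶠ n in atTop, p n ≤ ENNReal.ofReal (Real.exp (-(a n * (c - η)))))
    (hlo : ∀ η > 0, ∀ᶠ n in atTop, ENNReal.ofReal (Real.exp (-(a n * (c + η)))) ≤ p n) :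
    liminf (fun n => -((1 / a n : ℝ) : EReal) * ENNReal.log (p n)) atTop = (c : EReal) := by
  have key : ∀ {r : ℝ}, 0 < r → ∀ b : ℝ, -((1 / r : ℝ) : EReal) *
      ENNReal.log (ENNReal.ofReal (Real.exp (-(r * b)))) = (b : EReal) := by
    intro r hr b
    rw [ENNReal.log_ofReal_of_pos (Real.exp_pos _), Real.log_exp, ← EReal.coe_neg, ← EReal.coe_mul]
    congr 1; field_simp
  have anti : ∀ {r : ℝ}, 0 < r → ∀ {p q : ENNReal}, p ≤ q →
      -((1 / r : ℝ) : EReal) * ENNReal.log q ≤ -((1 / r : ℝ) : EReal) * ENNReal.log p := by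
    intro r hr p q hpq
    rw [EReal.neg_mul, EReal.neg_mul, EReal.neg_le_neg_iff]
    exact mul_le_mul_of_nonneg_left (ENNReal.log_le_log hpq)
      (EReal.coe_nonneg.mpr (by positivity))
  refine Tendsto.liminf_eq (tendsto_order.mpr ⟨fun b hb => ?_, fun b hb => ?_⟩)
  · obtain ⟨d, hbd, hdc⟩ := EReal.lt_iff_exists_real_btwn.mp hb
    have hdc' : d < c := by exact_mod_cast hdc
    filter_upwards [ha, hup (c - d) (by linarith)] with n hn hp
    refine hbd.trans_le ?_
    rw [← key hn d]
    refine anti hn (hp.trans_eq ?_)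
    ring_nf
  · obtain ⟨d, hcd, hdb⟩ := EReal.lt_iff_exists_real_btwn.mp hb
    have hcd' : c < d := by exact_mod_cast hcd
    filter_upwards [ha, hlo (d - c) (by linarith)] with n hn hp
    refine lt_of_le_of_lt ?_ hdb
    rw [← key hn d]
    refine anti hn (le_trans (le_of_eq ?_) hp)
    ring_nf

theorem zero_mem_interior_integrableExpSet_sq {μ : Measure ℝ} (s : ℝ)
    (hcgf : ∃ θ : ℝ, 0 < θ ∧ Integrable (fun x : ℝ => Real.exp (θ * x ^ 2)) μ) :
    0 ∈ interior (integrableExpSet (fun x : ℝ => x ^ 2 - s) μ) := by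
  obtain ⟨θ, hθ, hint⟩ := hcgf
  refine mem_interior.mpr ⟨Set.Iio θ, fun t ht => ?_, isOpen_Iio, hθ⟩
  have h : Integrable (fun x : ℝ => Real.exp (t * x ^ 2)) μ := by
    refine hint.mono' (by fun_prop) (ae_of_all _ fun x => ?_)
    rw [Real.norm_eq_abs, abs_of_pos (Real.exp_pos _)]
    exact Real.exp_le_exp.mpr (mul_le_mul_of_nonneg_right (le_of_lt ht) (sq_nonneg x))
  refine (h.mul_const (Real.exp (-(t * s)))).congr (ae_of_all _ fun x => ?_)
  simp only [← Real.exp_add]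
  ring_nf

theorem variance_sq_sub {μ : Measure ℝ} [IsProbabilityMeasure μ] {s ζ : ℝ}
    (hσ : ∫ x, x ^ 2 ∂μ = s) (h4 : Integrable (fun x : ℝ => x ^ 4) μ)
    (hζ : ∫ x, x ^ 4 ∂μ = ζ) : Var[fun x : ℝ => x ^ 2 - s; μ] = ζ - s ^ 2 := by
  have hLp : MemLp (fun x : ℝ => x ^ 2) 2 μ := by
    rw [memLp_two_iff_integrable_sq (by fun_prop)]
    simpa [← pow_mul] using h4
  rw [variance_sub_const (by fun_prop), variance_eq_sub hLp]
  simp [← pow_mul, hσ, hζ]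

theorem sum_sq_sub_eq {n : ℕ} (hn : 0 < n) (s : ℝ) (x : Fin n → ℝ) :
    ∑ i, (x i ^ 2 - s) = n * (meanSquare x - s) := by
  have : (n : ℝ) ≠ 0 := by positivity
  rw [meanSquare]
  simp only [Finset.sum_sub_distrib, Finset.sum_const, Finset.card_univ, Fintype.card_fin,
    nsmul_eq_mul]
  field_simp

/-- A codeword law whose hitting probabilities have first-order exponent
`R* + (‖xⁿ‖²/n - s) / (2 s)` attains the constant `1 / (2 V)`: the codebook fails essentially when
`‖Xⁿ‖²/n` exceeds `s + 2 s ξₙ`, an event in the moderate deviations range. -/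
theorem moderateDeviationsConstant_eq {μ : Measure ℝ} [IsProbabilityMeasure μ] {s ζ D : ℝ}
    (h2 : Integrable (fun x : ℝ => x ^ 2) μ) (hσ : ∫ x, x ^ 2 ∂μ = s)
    (h4 : Integrable (fun x : ℝ => x ^ 4) μ) (hζ : ∫ x, x ^ 4 ∂μ = ζ)
    (hcgf : ∃ θ : ℝ, 0 < θ ∧ Integrable (fun x : ℝ => Real.exp (θ * x ^ 2)) μ)
    (hD : 0 < D) (hDs : D < s) (hV : 0 < mismatchedDispersion s ζ)
    {ξ : ℕ → ℝ} (hξ : Tendsto ξ atTop (𝓝 0))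
    (hξ' : Tendsto (fun n : ℕ => √((n : ℝ) / Real.log n) * ξ n) atTop atTop)
    {Q : (n : ℕ) → Measure (Fin n → ℝ)} (hQ : ∀ᶠ n in atTop, IsProbabilityMeasure (Q n))
    (hhit : ∀ ε > 0, ∀ᶠ n : ℕ in atTop, ∀ x : Fin n → ℝ, s - 2 * s * ξ n ≤ meanSquare x →
      meanSquare x ≤ s + 2 * s * ξ n * (1 - ε) →
      ENNReal.ofReal (Real.exp (-(n * (rateDistortion s D + ξ n) - n * ξ n * (ε / 2)))) ≤
        Q n {y | distortion x y ≤ D})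
    (hmiss : ∀ ε > 0, ∀ᶠ n : ℕ in atTop, ∀ x : Fin n → ℝ,
      s + 2 * s * ξ n * (1 + ε) ≤ meanSquare x →
      Q n {y | distortion x y ≤ D} ≤
        ENNReal.ofReal (Real.exp (-(n * (rateDistortion s D + ξ n) + n * ξ n * (ε / 2))))) :
    moderateDeviationsConstant μ s D ξ Q = ((1 / (2 * mismatchedDispersion s ζ) : ℝ) : EReal) := by
  have hs : 0 < s := hD.trans hDs
  have hW : Measurable fun x : ℝ => x ^ 2 - s := by fun_prop
  have h0 := zero_mem_interior_integrableExpSet_sq s hcgf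
  have hmean : ∫ x : ℝ, (x ^ 2 - s) ∂μ = 0 := by
    rw [integral_sub h2 (integrable_const _)]; simp [hσ]
  have hvar := variance_sq_sub hσ h4 hζ
  set v := ζ - s ^ 2 with hv
  have hvpos : 0 < v := by
    rw [mismatchedDispersion] at hV
    exact (div_pos_iff_of_pos_right (by positivity)).mp hV
  set c := 1 / (2 * mismatchedDispersion s ζ) with hc
  have hcv : c = (2 * s) ^ 2 / (2 * v) := by
    rw [hc, mismatchedDispersion, ← hv]; field_simp; ring
  have hcpos : 0 < c := by positivity
  have hpos := eventually_pos_of_moderate hξ'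
  have hinf := tendsto_mul_sq_of_moderate hξ'
  have hR : 0 < rateDistortion s D := by
    rw [rateDistortion]
    have : 0 < Real.log (s / D) := Real.log_pos (by rw [one_lt_div hD]; exact hDs)
    linarith
  rw [moderateDeviationsConstant]
  refine liminf_neg_mul_log_eq (hinf.eventually_gt_atTop 0) (fun η hη => ?_) (fun η hη => ?_)
  · -- the codebook misses only if `‖Xⁿ‖²/n` leaves `[s - 2 s ξₙ, s + 2 s ξₙ (1 - ε)]`; both tails
    -- have exponent at least about `c`
    obtain ⟨ε, hε, hε1⟩ : ∃ ε : ℝ, 0 < ε ∧ 2 * ε * c ≤ η / 4 :=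
      ⟨η / (8 * c), by positivity, by field_simp; norm_num⟩
    have hup := moderate_deviations_upper hW h0 hmean (by rw [hvar]; exact hvpos) hξ hpos
      (2 * s * (1 - ε)) (η := η / 4) (by positivity)
    have hdn := moderate_deviations_upper hW h0 hmean (by rw [hvar]; exact hvpos) hξ hpos
      (-(2 * s)) (η := η / 4) (by positivity)
    rw [hvar] at hup hdn
    have hsmall : ∀ᶠ n in atTop, ξ n < ε / (2 * c) :=
      hξ.eventually_lt_const (by positivity)
    by_cases hε2 : 1 ≤ ε
    · -- here `c ≤ η / 8`, so the claimed bound is at least `1`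
      filter_upwards [hQ, hinf.eventually_gt_atTop 0] with n hQn hn
      have hle : excessDistortionProb μ D (Q n)
          (ceilExp ((n : ℝ) * (rateDistortion s D + ξ n))) ≤ 1 := prob_le_one
      refine hle.trans ?_
      rw [ENNReal.one_le_ofReal, Real.one_le_exp_iff]
      have : c - η ≤ 0 := by nlinarith
      nlinarith
    push Not at hε2
    filter_upwards [hQ, hhit ε hε, hup, hdn, hsmall, hpos, eventually_gt_atTop 0,
      hinf.eventually_ge_atTop (Real.log 3 / (η / 4))] with n hQn hx hup hdn hsm hξn hn hbig
    have hnR : (0 : ℝ) < n := by exact_mod_cast hn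
    set G : Set (Fin n → ℝ) := {x | s - 2 * s * ξ n ≤ meanSquare x} ∩
      {x | meanSquare x ≤ s + 2 * s * ξ n * (1 - ε)} with hG
    have hGm : MeasurableSet G := (measurableSet_le measurable_const measurable_meanSquare).inter
      (measurableSet_le measurable_meanSquare measurable_const)
    have hP := excessDistortionProb_le (μ := μ) (Q := Q n) hGm fun x hxG => hx x hxG.1 hxG.2
    refine hP.trans ?_
    have hGc : Gᶜ ⊆ {x | n * ξ n * (2 * s * (1 - ε)) ^ 2 ≤
          2 * s * (1 - ε) * ∑ i, (x i ^ 2 - s)} ∪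
        {x | n * ξ n * (-(2 * s)) ^ 2 ≤ -(2 * s) * ∑ i, (x i ^ 2 - s)} := by
      intro x hxG
      simp only [hG, Set.mem_compl_iff, Set.mem_inter_iff, Set.mem_ofPred_eq, not_and_or,
        not_le] at hxG
      simp only [Set.mem_union, Set.mem_ofPred_eq, sum_sq_sub_eq hn]
      have ha : 0 < 2 * s * (1 - ε) := mul_pos (by positivity) (by linarith)
      rcases hxG with h | h
      · right
        calc n * ξ n * (-(2 * s)) ^ 2 = (2 * s * n) * (2 * s * ξ n) := by ring
          _ ≤ (2 * s * n) * (s - meanSquare x) := by gcongr; linarith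
          _ = _ := by ring
      · left
        calc n * ξ n * (2 * s * (1 - ε)) ^ 2
            = (2 * s * (1 - ε) * n) * (2 * s * ξ n * (1 - ε)) := by ring
          _ ≤ (2 * s * (1 - ε) * n) * (meanSquare x - s) := by gcongr; linarith
          _ = _ := by ring
    set T := n * ξ n ^ 2 with hT
    have hTpos : 0 < T := by positivity
    have hb := (measure_mono (μ := Measure.pi fun _ : Fin n => μ) hGc).trans
      ((measure_union_le _ _).trans (add_le_add hup hdn))
    set B := ENNReal.ofReal (Real.exp (-(T * (c - 3 * η / 4)))) with hB
    have e1 : (2 * s * (1 - ε)) ^ 2 / (2 * v) = (1 - ε) ^ 2 * c := by rw [hcv]; ring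
    have e2 : (-(2 * s)) ^ 2 / (2 * v) = c := by rw [hcv]; ring
    have b1 : ENNReal.ofReal (Real.exp (-(T * ((2 * s * (1 - ε)) ^ 2 / (2 * v) - η / 4)))) ≤ B := by
      refine ENNReal.ofReal_le_ofReal (Real.exp_le_exp.mpr (neg_le_neg ?_))
      refine mul_le_mul_of_nonneg_left ?_ hTpos.le
      rw [e1]; nlinarith [mul_nonneg hcpos.le (sq_nonneg ε)]
    have b2 : ENNReal.ofReal (Real.exp (-(T * ((-(2 * s)) ^ 2 / (2 * v) - η / 4)))) ≤ B := by
      refine ENNReal.ofReal_le_ofReal (Real.exp_le_exp.mpr (neg_le_neg ?_))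
      refine mul_le_mul_of_nonneg_left ?_ hTpos.le
      rw [e2]; linarith
    have b3 : ENNReal.ofReal (Real.exp (-(n * ξ n * (ε / 2)))) ≤ B := by
      refine ENNReal.ofReal_le_ofReal (Real.exp_le_exp.mpr (neg_le_neg ?_))
      rw [lt_div_iff₀ (by positivity)] at hsm
      calc T * (c - 3 * η / 4) ≤ T * c := by gcongr; linarith
        _ = n * ξ n * (ξ n * c) := by rw [hT]; ring
        _ ≤ n * ξ n * (ε / 2) := by gcongr; linarith
    calc _ ≤ B + B + B := add_le_add (hb.trans (add_le_add b1 b2)) b3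
      _ = ENNReal.ofReal 3 * B := by
        rw [show ENNReal.ofReal 3 = 3 by norm_num]; ring
      _ ≤ _ := by
        rw [hB, ← ENNReal.ofReal_mul (by norm_num)]
        refine ENNReal.ofReal_le_ofReal ?_
        rw [show (3 : ℝ) * Real.exp (-(T * (c - 3 * η / 4))) =
          Real.exp (Real.log 3 + -(T * (c - 3 * η / 4))) by
            rw [Real.exp_add, Real.exp_log (by norm_num)]]
        refine Real.exp_le_exp.mpr ?_
        rw [div_le_iff₀ (by positivity)] at hbig
        linarith
  · -- once `‖Xⁿ‖²/n` exceeds `s + 2 s ξₙ (1 + ε)`, the codebook misses with probability `≥ 1/2`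
    obtain ⟨ε, hε, hε1⟩ : ∃ ε : ℝ, 0 < ε ∧ (2 * ε + ε ^ 2) * c ≤ η / 3 := by
      refine ⟨min 1 (η / (9 * c)), by positivity, ?_⟩
      have h1 : min 1 (η / (9 * c)) ≤ 1 := min_le_left _ _
      have h2 : min 1 (η / (9 * c)) ≤ η / (9 * c) := min_le_right _ _
      have h3 : 0 < min 1 (η / (9 * c)) := by positivity
      set e := min 1 (η / (9 * c))
      rw [le_div_iff₀ (by positivity)] at h2
      nlinarith [mul_pos h3 hcpos]
    have hlo := moderate_deviations_lower hW h0 hmean (by rw [hvar]; exact hvpos) hξ hpos hinf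
      (a := 2 * s * (1 + ε)) (by positivity) (η := η / 3) (by positivity)
    rw [hvar] at hlo
    filter_upwards [hQ, hmiss ε hε, hlo, hpos, eventually_gt_atTop 0,
      hinf.eventually_ge_atTop (Real.log 2 / (η / 3)),
      hinf.eventually_ge_atTop (Real.log 4 / (ε / 2)), hξ.eventually_lt_const one_pos]
      with n hQn hx hlo hξn hn hbig hbig2 hξ1
    have hnR : (0 : ℝ) < n := by exact_mod_cast hn
    set G : Set (Fin n → ℝ) := {x | s + 2 * s * ξ n * (1 + ε) ≤ meanSquare x} with hG
    have hGm : MeasurableSet G := measurableSet_le measurable_const measurable_meanSquare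
    have hy : Real.log 4 ≤ n * ξ n * (ε / 2) := by
      rw [div_le_iff₀ (by positivity)] at hbig2
      refine hbig2.trans ?_
      gcongr
      rw [sq]
      exact mul_le_of_le_one_left hξn.le hξ1.le
    have hP := le_excessDistortionProb (μ := μ) (Q := Q n) (by positivity) hy hGm hx
    refine le_trans ?_ hP
    have hGs : {x : Fin n → ℝ | n * ξ n * (2 * s * (1 + ε)) ≤ ∑ i, (x i ^ 2 - s)} ⊆ G := by
      intro x hx
      simp only [Set.mem_ofPred_eq, sum_sq_sub_eq hn] at hx
      simp only [hG, Set.mem_ofPred_eq]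
      have := le_of_mul_le_mul_left (by linarith :
        (n : ℝ) * (ξ n * (2 * s * (1 + ε))) ≤ n * (meanSquare x - s)) hnR
      linarith
    have hlo' := hlo.trans (measure_mono hGs)
    refine le_trans ?_ (mul_le_mul_right hlo' _)
    set T := n * ξ n ^ 2 with hT
    have hTpos : 0 < T := by positivity
    rw [← ENNReal.ofReal_mul (by norm_num)]
    refine ENNReal.ofReal_le_ofReal ?_
    rw [show (1 / 2 : ℝ) = Real.exp (-Real.log 2) by
      rw [Real.exp_neg, Real.exp_log (by norm_num)]; norm_num, ← Real.exp_add]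
    refine Real.exp_le_exp.mpr ?_
    have e1 : (2 * s * (1 + ε)) ^ 2 / (2 * v) = (1 + ε) ^ 2 * c := by rw [hcv]; ring
    rw [e1]
    rw [div_le_iff₀ (by positivity)] at hbig
    have : T * ((1 + ε) ^ 2 * c + η / 3) ≤ T * (c + 2 * η / 3) :=
      mul_le_mul_of_nonneg_left (by linarith) hTpos.le
    linarith

/-! ### Gaussian hitting probabilities -/

theorem prod_gaussianPDF {n : ℕ} (m : Fin n → ℝ) {v : ℝ} (hv : 0 < v) (y : Fin n → ℝ) :
    ∏ i, gaussianPDF (m i) v.toNNReal (y i) =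
      ENNReal.ofReal ((√(2 * Real.pi * v))⁻¹ ^ n *
        Real.exp (-((∑ i, (y i - m i) ^ 2) / (2 * v)))) := by
  simp only [gaussianPDF]
  rw [← ENNReal.ofReal_prod_of_nonneg fun i _ => gaussianPDFReal_nonneg _ _ _]
  congr 1
  simp only [gaussianPDFReal, Real.coe_toNNReal v hv.le, Finset.prod_mul_distrib,
    Finset.prod_const, Finset.card_univ, Fintype.card_fin, ← Real.exp_sum]
  congr 2
  rw [Finset.sum_div, ← Finset.sum_neg_distrib]
  exact Finset.sum_congr rfl fun i _ => by ring

/-- The change of measure between two Gaussian product laws with different means and variances. -/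
theorem gaussian_pi_le {n : ℕ} (m m' : Fin n → ℝ) {v w : ℝ} (hv : 0 < v) (hw : 0 < w)
    {A : Set (Fin n → ℝ)} (hA : MeasurableSet A) {b : ℝ}
    (hb : ∀ y ∈ A, (∑ i, (y i - m' i) ^ 2) / (2 * w) - (∑ i, (y i - m i) ^ 2) / (2 * v) ≤ b) :
    Measure.pi (fun i => gaussianReal (m i) v.toNNReal) A ≤
      ENNReal.ofReal (Real.exp (n / 2 * Real.log (w / v) + b)) *
        Measure.pi (fun i => gaussianReal (m' i) w.toNNReal) A := by
  have hv' : v.toNNReal ≠ 0 := by simpa using hv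
  have hw' : w.toNNReal ≠ 0 := by simpa using hw
  have e1 : ∀ i, gaussianReal (m i) v.toNNReal =
    volume.withDensity (gaussianPDF (m i) v.toNNReal) := fun i => gaussianReal_of_var_ne_zero _ hv'
  have e2 : ∀ i, gaussianReal (m' i) w.toNNReal =
    volume.withDensity (gaussianPDF (m' i) w.toNNReal) := fun i =>
      gaussianReal_of_var_ne_zero _ hw'
  have i1 : ∀ i, IsProbabilityMeasure (volume.withDensity (gaussianPDF (m i) v.toNNReal)) :=
    fun i => by rw [← e1 i]; infer_instance
  have i2 : ∀ i, IsProbabilityMeasure (volume.withDensity (gaussianPDF (m' i) w.toNNReal)) :=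
    fun i => by rw [← e2 i]; infer_instance
  simp only [e1, e2]
  refine pi_withDensity_apply_le (fun _ => volume) _ _ (fun i => measurable_gaussianPDF _ _)
    (fun i => measurable_gaussianPDF _ _) hA _ fun y hy => ?_
  rw [prod_gaussianPDF m hv, prod_gaussianPDF m' hw,
    ← ENNReal.ofReal_mul (Real.exp_pos _).le]
  refine ENNReal.ofReal_le_ofReal ?_
  have hratio : (√(2 * Real.pi * v))⁻¹ ^ n =
      Real.exp (n / 2 * Real.log (w / v)) * (√(2 * Real.pi * w))⁻¹ ^ n := by
    have h1 : Real.exp (n / 2 * Real.log (w / v)) = √(w / v) ^ n := by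
      rw [Real.sqrt_eq_rpow, Real.rpow_def_of_pos (by positivity), ← Real.exp_nat_mul]
      congr 1; ring
    rw [h1, ← mul_pow]
    congr 1
    rw [Real.sqrt_div hw.le, Real.sqrt_mul (by positivity) v, Real.sqrt_mul (by positivity) w]
    have := (Real.sqrt_pos.mpr hv).ne'
    have := (Real.sqrt_pos.mpr hw).ne'
    field_simp
  rw [hratio, Real.exp_add]
  have hexp : Real.exp (-((∑ i, (y i - m i) ^ 2) / (2 * v))) ≤
      Real.exp b * Real.exp (-((∑ i, (y i - m' i) ^ 2) / (2 * w))) := by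
    rw [← Real.exp_add]
    exact Real.exp_le_exp.mpr (by linarith [hb y hy])
  calc _ ≤ Real.exp (n / 2 * Real.log (w / v)) * (√(2 * Real.pi * w))⁻¹ ^ n *
        (Real.exp b * Real.exp (-((∑ i, (y i - m' i) ^ 2) / (2 * w)))) := by gcongr
    _ = _ := by ring

theorem sum_sq_eq {n : ℕ} (hn : 0 < n) (x : Fin n → ℝ) : ∑ i, x i ^ 2 = n * meanSquare x := by
  simpa using sum_sq_sub_eq hn 0 x

theorem sum_sub_sq_eq {n : ℕ} (hn : 0 < n) (x y : Fin n → ℝ) :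
    ∑ i, (x i - y i) ^ 2 = n * distortion x y := by
  have : (n : ℝ) ≠ 0 := by positivity
  rw [distortion]; field_simp

/-- The Chernoff bound at the optimal parameter `1 / (2 D)`, whose exponent is linear in both
`‖x‖²/n` and the distortion level. Completing the square turns the exponential weight into the
density of `⊗ᵢ 𝓝(P xᵢ / s, P D / s)`. -/
theorem gaussianCodeword_distortion_le {s D : ℝ} (hD : 0 < D) (hDs : D < s) {n : ℕ} (hn : 0 < n)
    (x : Fin n → ℝ) (D' : ℝ) :
    gaussianCodeword (s - D) n {y | distortion x y ≤ D'} ≤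
      ENNReal.ofReal (Real.exp (-(n * (rateDistortion s D + (meanSquare x - s) / (2 * s) -
        (D' - D) / (2 * D))))) := by
  have hs : 0 < s := hD.trans hDs
  have hP : 0 < s - D := by linarith
  have h := gaussian_pi_le (fun _ : Fin n => 0) (fun i => (s - D) / s * x i) hP
    (by positivity : 0 < (s - D) * D / s) (measurableSet_distortion_le x D')
    (b := n * (D' / (2 * D) - meanSquare x / (2 * s))) (by
      intro y hy
      have hy' : distortion x y ≤ D' := hy
      have hterm : ∀ i, (y i - (s - D) / s * x i) ^ 2 / (2 * ((s - D) * D / s)) -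
          (y i - 0) ^ 2 / (2 * (s - D)) = (x i - y i) ^ 2 / (2 * D) - x i ^ 2 / (2 * s) := by
        intro i; field_simp; ring
      rw [Finset.sum_div, Finset.sum_div, ← Finset.sum_sub_distrib,
        Finset.sum_congr rfl fun i _ => hterm i, Finset.sum_sub_distrib, ← Finset.sum_div,
        ← Finset.sum_div, sum_sub_sq_eq hn, sum_sq_eq hn, mul_sub, mul_div_assoc, mul_div_assoc]
      gcongr)
  refine h.trans ((mul_le_of_le_one_right' prob_le_one).trans (ENNReal.ofReal_le_ofReal
    (Real.exp_le_exp.mpr (le_of_eq ?_))))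
  have hlog : Real.log ((s - D) * D / s / (s - D)) = -Real.log (s / D) := by
    rw [← Real.log_inv]; congr 1; field_simp
  rw [hlog, rateDistortion]
  field_simp
  ring

theorem gaussianReal_eq_map_standard (m : ℝ) {w : ℝ} (hw : 0 < w) :
    gaussianReal m w.toNNReal = (gaussianReal 0 1).map fun g => √w * g + m := by
  have h1 := gaussianReal_map_const_mul (μ := 0) (v := 1) √w
  have h2 := gaussianReal_map_add_const (μ := √w * 0) (v := NNReal.mk (√w ^ 2) (sq_nonneg _) * 1) m
  rw [← h1, Measure.map_map (by fun_prop) (by fun_prop)] at h2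
  rw [show (fun g => √w * g + m) = (fun x => x + m) ∘ (fun x => √w * x) from rfl, h2]
  congr 1
  · simp
  · ext; simp [Real.sq_sqrt hw.le, hw.le]

theorem memLp_sq_gaussianReal (m c : ℝ) (v : NNReal) :
    MemLp (fun y : ℝ => (y - c) ^ 2) 2 (gaussianReal m v) := by
  rw [memLp_two_iff_integrable_sq (by fun_prop)]
  have h : MemLp (fun y : ℝ => y - c) 4 (gaussianReal m v) :=
    (memLp_id_gaussianReal 4).sub (memLp_const c)
  have := h.integrable_norm_pow (by norm_num)
  refine this.congr (ae_of_all _ fun y => ?_)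
  simp only [Real.norm_eq_abs]
  rw [← pow_mul]
  exact (Even.pow_abs (by decide : Even (2 * 2)) _)

theorem integral_sub_sq_gaussianReal (m : ℝ) {w : ℝ} (hw : 0 < w) :
    ∫ y, ((y - m) ^ 2 - w) ∂(gaussianReal m w.toNNReal) = 0 := by
  rw [integral_sub ((memLp_sq_gaussianReal _ _ _).integrable (by norm_num)) (integrable_const _)]
  have h := variance_fun_id_gaussianReal (μ := m) (v := w.toNNReal)
  rw [variance_eq_integral (by fun_prop), integral_id_gaussianReal] at h
  simp [h, hw.le]

theorem variance_sub_sq_gaussianReal (m : ℝ) {w : ℝ} (hw : 0 < w) :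
    Var[fun y => (y - m) ^ 2 - w; gaussianReal m w.toNNReal] =
      w ^ 2 * Var[fun g : ℝ => g ^ 2; gaussianReal 0 1] := by
  rw [variance_sub_const (by fun_prop), gaussianReal_eq_map_standard m hw,
    variance_map (by fun_prop) (by fun_prop), ← variance_const_mul]
  congr 1
  ext g
  simp only [Function.comp_apply, add_sub_cancel_right]
  rw [mul_pow, Real.sq_sqrt hw.le]

/-- The event that the residual `y - m x` has nearly the energy `n w` and is nearly orthogonal
to `x`. -/
def typicalSet {n : ℕ} (x : Fin n → ℝ) (m w δ : ℝ) : Set (Fin n → ℝ) :=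
  {y | |∑ i, ((y i - m * x i) ^ 2 - w)| < n * δ} ∩ {y | |∑ i, x i * (y i - m * x i)| < n * δ}

theorem measurableSet_typicalSet {n : ℕ} (x : Fin n → ℝ) (m w δ : ℝ) :
    MeasurableSet (typicalSet x m w δ) :=
  (measurableSet_lt (by fun_prop) measurable_const).inter
    (measurableSet_lt (by fun_prop) measurable_const)

theorem half_le_typicalSet {n : ℕ} (hn : 0 < n) (x : Fin n → ℝ) (m : ℝ) {w δ : ℝ} (hw : 0 < w)
    (hδ : 0 < δ)
    (h1 : w ^ 2 * Var[fun g : ℝ => g ^ 2; gaussianReal 0 1] ≤ n * δ ^ 2 / 4)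
    (h2 : meanSquare x * w ≤ n * δ ^ 2 / 4) :
    ENNReal.ofReal (1 / 2) ≤
      Measure.pi (fun i => gaussianReal (m * x i) w.toNNReal) (typicalSet x m w δ) := by
  have hnR : (0 : ℝ) < n := by exact_mod_cast hn
  have hc : 0 < n * δ := by positivity
  refine half_le_of_compl_le (measurableSet_typicalSet x m w δ) ?_
  have hsub : (typicalSet x m w δ)ᶜ ⊆ {y | n * δ ≤ |∑ i, ((y i - m * x i) ^ 2 - w)|} ∪
      {y | n * δ ≤ |∑ i, x i * (y i - m * x i)|} := by
    intro y hy
    simpa [typicalSet, Classical.not_and_iff_not_or_not, or_iff_not_imp_left] using hy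
  have c1 := pi_abs_sum_ge_le (fun i => gaussianReal (m * x i) w.toNNReal)
    (fun i y => (y - m * x i) ^ 2 - w)
    (fun i => (memLp_sq_gaussianReal _ _ _).sub (memLp_const w))
    (fun i => integral_sub_sq_gaussianReal _ hw) hc
  have c2 := pi_abs_sum_ge_le (fun i => gaussianReal (m * x i) w.toNNReal)
    (fun i y => x i * (y - m * x i))
    (fun i => ((memLp_id_gaussianReal 2).sub (memLp_const (m * x i))).const_mul (x i))
    (fun i => by
      have hid : Integrable (fun y : ℝ => y) (gaussianReal (m * x i) w.toNNReal) :=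
        (memLp_id_gaussianReal 1).integrable le_rfl
      rw [integral_const_mul, integral_sub hid (integrable_const _)]
      simp) hc
  have b1 : (∑ i, Var[fun y => (y - m * x i) ^ 2 - w; gaussianReal (m * x i) w.toNNReal]) /
      (n * δ) ^ 2 ≤ 1 / 4 := by
    simp only [variance_sub_sq_gaussianReal _ hw, Finset.sum_const, Finset.card_univ,
      Fintype.card_fin, nsmul_eq_mul]
    rw [div_le_iff₀ (by positivity)]
    have := mul_le_mul_of_nonneg_left h1 hnR.le
    linarith
  have b2 : (∑ i, Var[fun y => x i * (y - m * x i); gaussianReal (m * x i) w.toNNReal]) /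
      (n * δ) ^ 2 ≤ 1 / 4 := by
    have : ∀ i, Var[fun y => x i * (y - m * x i); gaussianReal (m * x i) w.toNNReal] =
        x i ^ 2 * w := by
      intro i
      rw [variance_const_mul, variance_sub_const (by fun_prop), variance_fun_id_gaussianReal]
      simp [hw.le]
    simp only [this]
    rw [← Finset.sum_mul, sum_sq_eq hn, div_le_iff₀ (by positivity)]
    have := mul_le_mul_of_nonneg_left h2 hnR.le
    linarith
  calc _ ≤ _ := measure_mono hsub
    _ ≤ _ := measure_union_le _ _
    _ ≤ ENNReal.ofReal (1 / 4) + ENNReal.ofReal (1 / 4) := add_le_add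
        (c1.trans (ENNReal.ofReal_le_ofReal b1)) (c2.trans (ENNReal.ofReal_le_ofReal b2))
    _ = ENNReal.ofReal (1 / 2) := by
        rw [← ENNReal.ofReal_add (by norm_num) (by norm_num)]; norm_num

/-- With `m = (z + P - d) / (2 z)` and `w = P - m² z` a typical `y` has power close to `P` and lies
at distortion close to `d` from `x`. -/
theorem typicalSet_subset {n : ℕ} (hn : 0 < n) {x : Fin n → ℝ} {m w δ P d : ℝ}
    (hm0 : 0 ≤ m) (hm1 : m ≤ 1) (hδ : 0 < δ) (hw : w = P - m ^ 2 * meanSquare x)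
    (hd : meanSquare x - 2 * m * meanSquare x + P = d) {y : Fin n → ℝ}
    (hy : y ∈ typicalSet x m w δ) :
    |meanSquare y - P| ≤ 3 * δ ∧ distortion x y ≤ d + 3 * δ ∧
      n * (w - δ) ≤ ∑ i, (y i - m * x i) ^ 2 := by
  have hnR : (0 : ℝ) < n := by exact_mod_cast hn
  obtain ⟨h1, h2⟩ := hy
  simp only [Set.mem_ofPred_eq, Finset.sum_sub_distrib, Finset.sum_const, Finset.card_univ,
    Fintype.card_fin, nsmul_eq_mul] at h1 h2
  set S := ∑ i, (y i - m * x i) ^ 2 with hS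
  set B := ∑ i, x i * (y i - m * x i) with hB
  obtain ⟨l1, u1⟩ := abs_lt.mp h1
  obtain ⟨l2, u2⟩ := abs_lt.mp h2
  have eA : n * meanSquare y = S + 2 * m * B + m ^ 2 * (n * meanSquare x) := by
    rw [← sum_sq_eq hn, ← sum_sq_eq hn, hS, hB, Finset.mul_sum, Finset.mul_sum,
      ← Finset.sum_add_distrib, ← Finset.sum_add_distrib]
    exact Finset.sum_congr rfl fun i _ => by ring
  have eD : n * distortion x y = (1 - m) ^ 2 * (n * meanSquare x) - 2 * (1 - m) * B + S := by
    rw [← sum_sq_eq hn, ← sum_sub_sq_eq hn, hS, hB, Finset.mul_sum, Finset.mul_sum,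
      ← Finset.sum_sub_distrib, ← Finset.sum_add_distrib]
    exact Finset.sum_congr rfl fun i _ => by ring
  have hc : 0 < n * δ := by positivity
  have k1 : m * B ≤ n * δ := by nlinarith
  have k2 : -(n * δ) ≤ m * B := by nlinarith
  have k3 : -(n * δ) ≤ (1 - m) * B := by nlinarith
  refine ⟨abs_le.mpr ⟨?_, ?_⟩, ?_, by linarith⟩
  · refine le_of_mul_le_mul_left (a := (n : ℝ)) ?_ hnR
    rw [mul_sub, eA]
    have : n * w = n * P - m ^ 2 * (n * meanSquare x) := by rw [hw]; ring
    linarith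
  · refine le_of_mul_le_mul_left (a := (n : ℝ)) ?_ hnR
    rw [mul_sub, eA]
    have : n * w = n * P - m ^ 2 * (n * meanSquare x) := by rw [hw]; ring
    linarith
  · refine le_of_mul_le_mul_left (a := (n : ℝ)) ?_ hnR
    rw [eD]
    have : n * w = n * P - m ^ 2 * (n * meanSquare x) := by rw [hw]; ring
    have : n * d = n * meanSquare x - 2 * m * (n * meanSquare x) + n * P := by rw [← hd]; ring
    linarith

/-- Under `⊗ᵢ 𝓝(m xᵢ, w)` the typical set has probability at least `1/2`, and on it the likelihood
ratio to `⊗ᵢ 𝓝(0, P)` is at most `exp (n/2 log (P / w) + O(n δ))`. -/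
theorem le_gaussianCodeword_typical {n : ℕ} (hn : 0 < n) {x : Fin n → ℝ} {m w δ P d : ℝ}
    (hP : 0 < P) (hm0 : 0 ≤ m) (hm1 : m ≤ 1) (hδ : 0 < δ) (hw0 : 0 < w)
    (hw : w = P - m ^ 2 * meanSquare x) (hd : meanSquare x - 2 * m * meanSquare x + P = d)
    (h1 : w ^ 2 * Var[fun g : ℝ => g ^ 2; gaussianReal 0 1] ≤ n * δ ^ 2 / 4)
    (h2 : meanSquare x * w ≤ n * δ ^ 2 / 4) :
    ENNReal.ofReal (Real.exp (-(n / 2 * Real.log (P / w) +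
      n * δ * (3 / (2 * P) + 1 / (2 * w)) + Real.log 2))) ≤
      gaussianCodeword P n {y | distortion x y ≤ d + 3 * δ ∧ |meanSquare y - P| ≤ 3 * δ} := by
  have hnR : (0 : ℝ) < n := by exact_mod_cast hn
  have h := gaussian_pi_le (fun i => m * x i) (fun _ : Fin n => 0) hw0 hP
    (measurableSet_typicalSet x m w δ) (b := n * δ * (3 / (2 * P) + 1 / (2 * w))) (by
      intro y hy
      obtain ⟨k1, -, k3⟩ := typicalSet_subset hn hm0 hm1 hδ hw hd hy
      simp only [sub_zero]
      rw [sum_sq_eq hn]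
      have := (abs_le.mp k1).2
      calc _ ≤ n * (P + 3 * δ) / (2 * P) - n * (w - δ) / (2 * w) := by
            gcongr; linarith
        _ = _ := by field_simp; ring)
  have hhalf := (half_le_typicalSet hn x m hw0 hδ h1 h2).trans h
  set L := n / 2 * Real.log (P / w) + n * δ * (3 / (2 * P) + 1 / (2 * w)) with hL
  refine le_trans ?_ (measure_mono (s := typicalSet x m w δ) fun _ hy =>
    ⟨(typicalSet_subset hn hm0 hm1 hδ hw hd hy).2.1, (typicalSet_subset hn hm0 hm1 hδ hw hd hy).1⟩)
  calc ENNReal.ofReal (Real.exp (-(L + Real.log 2)))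
      = ENNReal.ofReal (Real.exp (-L)) * ENNReal.ofReal (1 / 2) := by
        rw [← ENNReal.ofReal_mul (Real.exp_pos _).le, neg_add, Real.exp_add, Real.exp_neg
          (Real.log 2), Real.exp_log (by norm_num)]
        norm_num
    _ ≤ ENNReal.ofReal (Real.exp (-L)) * (ENNReal.ofReal (Real.exp L) * _) :=
        mul_le_mul_right hhalf _
    _ = _ := by
        rw [← mul_assoc, ← ENNReal.ofReal_mul (Real.exp_pos _).le, ← Real.exp_add]
        simp [gaussianCodeword]

/-- The first-order bound on the exponent `½ log (P / w)`. For `‖x‖²/n = s (1 + 2 u)` and target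
distortion `D - e`, the variance `w` of the changed measure has the form below with
`y = e / D + (2 s u + e)² / (4 P D)`. -/
theorem half_log_div_le {s D u w y : ℝ} (hD : 0 < D) (hDs : D < s)
    (hu : 0 < 1 + 2 * u) (hy0 : 0 ≤ y) (hy1 : y ≤ 1 / 2) (hw : w = (s - D) * (D / s) * ((1 - y) / (1 + 2 * u))) :
    1 / 2 * Real.log ((s - D) / w) ≤ rateDistortion s D + u + y := by
  have hs : 0 < s := hD.trans hDs
  have hP : 0 < s - D := by linarith
  have h1y : 0 < 1 - y := by linarith
  have e1 : (s - D) / w = (s / D) * ((1 + 2 * u) * (1 - y)⁻¹) := by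
    rw [hw]; field_simp
  rw [e1, Real.log_mul (by positivity) (by positivity), Real.log_mul hu.ne' (by positivity),
    Real.log_inv, rateDistortion]
  have h1 := Real.log_le_sub_one_of_pos hu
  have h2 := Real.one_sub_inv_le_log_of_pos h1y
  have h3 : (1 - y)⁻¹ ≤ 1 + 2 * y := by
    rw [inv_le_iff_one_le_mul₀ h1y]; nlinarith
  linarith

/-- The lower bound on the hitting probability of a Gaussian codeword. The margin `C κ ξₙ` in the
distortion and the window for the power of the codeword cost nothing in the Gaussian case; they
transfer the bound to spherical codewords. -/
theorem eventually_le_gaussianCodeword {s D : ℝ} (hD : 0 < D) (hDs : D < s) {ξ : ℕ → ℝ}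
    (hξ : Tendsto ξ atTop (𝓝 0)) (hpos : ∀ᶠ n in atTop, 0 < ξ n)
    (hinf : Tendsto (fun n : ℕ => n * ξ n ^ 2) atTop atTop) {C ε : ℝ} (hC : 0 ≤ C) (hε : 0 < ε) :
    ∃ κ : ℝ, 0 < κ ∧ κ ≤ 1 ∧ ∀ᶠ n : ℕ in atTop, ∀ x : Fin n → ℝ,
      s - 2 * s * ξ n ≤ meanSquare x → meanSquare x ≤ s + 2 * s * ξ n * (1 - ε) →
      ENNReal.ofReal (Real.exp (-(n * (rateDistortion s D + ξ n) - n * ξ n * (ε / 2)))) ≤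
        gaussianCodeword (s - D) n {y | distortion x y ≤ D - C * (κ * ξ n) ∧
          |meanSquare y - (s - D)| ≤ 3 * (κ * ξ n)} := by
  have hs : 0 < s := hD.trans hDs
  set P := s - D with hPdef
  have hP : 0 < P := by rw [hPdef]; linarith
  set c₁ := (C + 3) / D + 3 / (2 * P) + 3 * s / (2 * P * D) with hc₁
  have hc₁pos : 0 < c₁ := by positivity
  obtain ⟨κ, hκ, hκ1, hκ2⟩ : ∃ κ : ℝ, 0 < κ ∧ κ ≤ 1 ∧ κ * c₁ ≤ ε / 8 := by
    refine ⟨min 1 (ε / 8 / c₁), by positivity, min_le_left _ _, ?_⟩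
    rw [← le_div_iff₀ hc₁pos]
    exact min_le_right _ _
  refine ⟨κ, hκ, hκ1, ?_⟩
  set K := Var[fun g : ℝ => g ^ 2; gaussianReal 0 1] with hK
  set c₂ := (2 * s + C + 3) ^ 2 / (4 * P * D) with hc₂
  have hc₂pos : 0 < c₂ := by positivity
  filter_upwards [hpos, eventually_gt_atTop 0,
    hξ.eventually_lt_const (by norm_num : (0 : ℝ) < 1 / 4),
    hξ.eventually_lt_const (by positivity : 0 < P / s),
    hξ.eventually_lt_const (by positivity : 0 < 2 * D / (C + 3 + 2 * s)),
    hξ.eventually_lt_const (by positivity : 0 < 1 / (2 * ((C + 3) / D + c₂))),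
    hξ.eventually_lt_const (by positivity : 0 < ε / 8 / c₂),
    hinf.eventually_ge_atTop (4 * (P ^ 2 * K) / κ ^ 2),
    hinf.eventually_ge_atTop (4 * (3 / 2 * s * P) / κ ^ 2),
    hinf.eventually_ge_atTop (Real.log 2 / (ε / 4))]
    with n hξn hn x1 x2 x3 x4 x5 b1 b2 b3 x hz1 hz2
  have hnR : (0 : ℝ) < n := by exact_mod_cast hn
  rw [lt_div_iff₀ (by positivity)] at x2 x3 x4 x5
  rw [div_le_iff₀ (by positivity)] at b1 b2 b3
  set t := ξ n with ht
  set δ := κ * t with hδ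
  have hδ0 : 0 < δ := by positivity
  have hδt : δ ≤ t := mul_le_of_le_one_left hξn.le hκ1
  set e := (C + 3) * δ with he
  have he0 : 0 ≤ e := by positivity
  have het : e ≤ (C + 3) * t := by rw [he]; gcongr
  set z := meanSquare x with hz
  set u := (z - s) / (2 * s) with hu
  have hzu : z = s * (1 + 2 * u) := by rw [hu]; field_simp; ring
  have hu1 : -t ≤ u := by rw [hu, le_div_iff₀ (by positivity)]; linarith
  have hu2 : u ≤ t * (1 - ε) := by rw [hu, div_le_iff₀ (by positivity)]; linarith
  have hu3 : u ≤ t := hu2.trans (mul_le_of_le_one_right hξn.le (by linarith))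
  have hv : 1 / 2 ≤ 1 + 2 * u := by linarith
  have hv0 : 0 < 1 + 2 * u := by linarith
  have hz0 : 0 < z := by rw [hzu]; positivity
  have hsu1 : -(s * t) ≤ s * u := by have := mul_le_mul_of_nonneg_left hu1 hs.le; linarith
  have hsu2 : s * u ≤ s * t := mul_le_mul_of_nonneg_left hu3 hs.le
  set m := (z + P - (D - e)) / (2 * z) with hm
  have hm0 : 0 ≤ m := by
    refine div_nonneg ?_ (by positivity)
    rw [hzu]; linarith
  have hm1 : m ≤ 1 := by
    rw [hm, div_le_one (by positivity), hzu]
    have : (C + 3 + 2 * s) * t = (C + 3) * t + 2 * (s * t) := by ring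
    linarith
  set y := e / D + (2 * s * u + e) ^ 2 / (4 * P * D) with hy
  have hy0 : 0 ≤ y := by positivity
  have hsq : (2 * s * u + e) ^ 2 ≤ ((2 * s + C + 3) * t) ^ 2 := by
    refine sq_le_sq' ?_ ?_
    · have : 0 ≤ (C + 3) * t := by positivity
      linarith
    · linarith
  have hyt : y ≤ t * (κ * ((C + 3) / D) + t * c₂) := by
    have : (2 * s * u + e) ^ 2 / (4 * P * D) ≤ ((2 * s + C + 3) * t) ^ 2 / (4 * P * D) := by
      gcongr
    calc y ≤ e / D + ((2 * s + C + 3) * t) ^ 2 / (4 * P * D) := by rw [hy]; linarith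
      _ = _ := by rw [he, hδ, hc₂]; ring
  have hy1 : y ≤ 1 / 2 := by
    have k1 : κ * ((C + 3) / D) ≤ (C + 3) / D := mul_le_of_le_one_left (by positivity) hκ1
    have k2 : t * c₂ ≤ c₂ := mul_le_of_le_one_left hc₂pos.le (by linarith)
    have k3 := mul_le_mul_of_nonneg_left (add_le_add k1 k2) hξn.le
    linarith
  set w := P - m ^ 2 * z with hw
  have hwe : w = (s - D) * (D / s) * ((1 - y) / (1 + 2 * u)) := by
    rw [hw, hm, hy, hzu, ← hPdef, show D = s - P by rw [hPdef]; ring]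
    have : s - P ≠ 0 := by rw [hPdef]; simpa using hD.ne'
    have := hP.ne'
    have := hv0.ne'
    field_simp
    ring
  have hwlo : P * D / (3 * s) ≤ w := by
    rw [hwe, ← hPdef]
    have : 1 / 3 ≤ (1 - y) / (1 + 2 * u) := by
      rw [le_div_iff₀ hv0]; linarith
    calc P * D / (3 * s) = P * (D / s) * (1 / 3) := by field_simp
      _ ≤ _ := by gcongr
  have hw0 : 0 < w := lt_of_lt_of_le (by positivity) hwlo
  have hwP : w ≤ P := by
    rw [hw]; have : 0 ≤ m ^ 2 * z := by positivity
    linarith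
  have hlog := half_log_div_le hD hDs hv0 hy0 hy1 hwe
  rw [← hPdef] at hlog
  have hKnn : 0 ≤ K := variance_nonneg _ _
  have hκt : n * δ ^ 2 = n * t ^ 2 * κ ^ 2 := by rw [hδ]; ring
  have h := le_gaussianCodeword_typical hn (x := x) (d := D - e) hP hm0 hm1 hδ0 hw0 hw
    (by rw [← hz, hm]; field_simp; ring)
    (by
      have : w ^ 2 * K ≤ P ^ 2 * K := by gcongr
      rw [hκt]; linarith)
    (by
      have : z * w ≤ (3 / 2 * s) * P := by
        gcongr
        have : s * t ≤ s * (1 / 4) := by gcongr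
        rw [hzu]; linarith
      rw [← hz, hκt]; linarith)
  have hde : D - e + 3 * δ = D - C * δ := by rw [he]; ring
  rw [hde] at h
  refine le_trans (ENNReal.ofReal_le_ofReal (Real.exp_le_exp.mpr (neg_le_neg ?_))) h
  have hwinv : 1 / (2 * w) ≤ 3 * s / (2 * P * D) := by
    rw [div_le_div_iff₀ (by positivity) (by positivity)]
    rw [div_le_iff₀ (by positivity)] at hwlo
    linarith
  have hlog2 : Real.log 2 ≤ n * (t * (ε / 4)) := by
    refine b3.trans ?_
    have : t ^ 2 ≤ t := by rw [sq]; exact mul_le_of_le_one_left hξn.le (by linarith)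
    calc n * t ^ 2 * (ε / 4) ≤ n * t * (ε / 4) := by gcongr
      _ = _ := by ring
  have hcost : y + δ * (3 / (2 * P) + 1 / (2 * w)) ≤ t * (ε / 4) := by
    calc y + δ * (3 / (2 * P) + 1 / (2 * w))
        ≤ t * (κ * ((C + 3) / D) + t * c₂) + δ * (3 / (2 * P) + 3 * s / (2 * P * D)) := by
          gcongr
      _ = t * (κ * c₁ + t * c₂) := by rw [hδ, hc₁]; ring
      _ ≤ t * (ε / 8 + ε / 8) := by gcongr
      _ = _ := by ring
  have hsum : 1 / 2 * Real.log (P / w) + δ * (3 / (2 * P) + 1 / (2 * w)) ≤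
      rateDistortion s D + t - t * (3 * ε / 4) := by linarith
  have := mul_le_mul_of_nonneg_left hsum hnR.le
  linarith

theorem gaussianCodeword_hit {s D : ℝ} (hD : 0 < D) (hDs : D < s) {ξ : ℕ → ℝ}
    (hξ : Tendsto ξ atTop (𝓝 0)) (hpos : ∀ᶠ n in atTop, 0 < ξ n)
    (hinf : Tendsto (fun n : ℕ => n * ξ n ^ 2) atTop atTop) {ε : ℝ} (hε : 0 < ε) :
    ∀ᶠ n : ℕ in atTop, ∀ x : Fin n → ℝ, s - 2 * s * ξ n ≤ meanSquare x →
      meanSquare x ≤ s + 2 * s * ξ n * (1 - ε) →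
      ENNReal.ofReal (Real.exp (-(n * (rateDistortion s D + ξ n) - n * ξ n * (ε / 2)))) ≤
        gaussianCodeword (s - D) n {y | distortion x y ≤ D} := by
  obtain ⟨κ, -, -, h⟩ := eventually_le_gaussianCodeword hD hDs hξ hpos hinf le_rfl hε
  filter_upwards [h] with n hn x h1 h2
  refine (hn x h1 h2).trans (measure_mono fun y hy => ?_)
  simpa using hy.1

theorem gaussianCodeword_miss {s D : ℝ} (hD : 0 < D) (hDs : D < s) {ξ : ℕ → ℝ}
    (hpos : ∀ᶠ n in atTop, 0 < ξ n) {ε : ℝ} (hε : 0 < ε) :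
    ∀ᶠ n : ℕ in atTop, ∀ x : Fin n → ℝ, s + 2 * s * ξ n * (1 + ε) ≤ meanSquare x →
      gaussianCodeword (s - D) n {y | distortion x y ≤ D} ≤
        ENNReal.ofReal (Real.exp (-(n * (rateDistortion s D + ξ n) + n * ξ n * (ε / 2)))) := by
  have hs : 0 < s := hD.trans hDs
  filter_upwards [eventually_gt_atTop 0, hpos] with n hn hξn x hx
  refine (gaussianCodeword_distortion_le hD hDs hn x D).trans
    (ENNReal.ofReal_le_ofReal (Real.exp_le_exp.mpr (neg_le_neg ?_)))
  have h1 : ξ n * (1 + ε) ≤ (meanSquare x - s) / (2 * s) := by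
    rw [le_div_iff₀ (by positivity)]; linarith
  have h2 : 0 ≤ ξ n * ε := by positivity
  have h3 : rateDistortion s D + ξ n + ξ n * (ε / 2) ≤
      rateDistortion s D + (meanSquare x - s) / (2 * s) - (D - D) / (2 * D) := by
    rw [sub_self, zero_div]; linarith
  have := mul_le_mul_of_nonneg_left h3 (Nat.cast_nonneg (α := ℝ) n)
  linarith

/-! ### Spherical codewords as normalized Gaussian codewords -/

/-- Integration in polar coordinates. -/
theorem lintegral_eq_lintegral_toSphere_prod {E : Type*} [NormedAddCommGroup E] [NormedSpace ℝ E]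
    [MeasurableSpace E] [BorelSpace E] [FiniteDimensional ℝ E] [Nontrivial E] (μ : Measure E)
    [μ.IsAddHaarMeasure] (f : E → ENNReal) :
    ∫⁻ x, f x ∂μ = ∫⁻ p, f ((p.2 : ℝ) • (p.1 : E))
      ∂(μ.toSphere.prod (Measure.volumeIoiPow (Module.finrank ℝ E - 1))) := by
  rw [← μ.measurePreserving_homeomorphUnitSphereProd.lintegral_comp_emb
    (Homeomorph.measurableEmbedding _)]
  have h : ∀ a : ({0}ᶜ : Set E), f (((homeomorphUnitSphereProd E a).2 : ℝ) •
      ((homeomorphUnitSphereProd E a).1 : E)) = f a := by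
    intro a
    have ha : ‖(a : E)‖ ≠ 0 := norm_ne_zero_iff.mpr a.2
    simp [smul_smul, ha]
  simp_rw [h]
  rw [lintegral_subtype_comap (measurableSet_singleton _).compl, restrict_compl_singleton]

/-- The rescaling of a nonzero sequence to power `P`; the zero sequence is left at `0`. -/
def normalize (P : ℝ) {n : ℕ} (y : Fin n → ℝ) : Fin n → ℝ := fun i => √P / √(meanSquare y) * y i

theorem measurable_normalize (P : ℝ) {n : ℕ} :
    Measurable (normalize P : (Fin n → ℝ) → Fin n → ℝ) := by
  unfold normalize meanSquare
  fun_prop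

theorem gaussianCodeword_eq_withDensity {P : ℝ} (hP : 0 < P) {n : ℕ} (hn : 0 < n) :
    gaussianCodeword P n = volume.withDensity fun y : Fin n → ℝ =>
      ENNReal.ofReal ((√(2 * Real.pi * P))⁻¹ ^ n * Real.exp (-(n * meanSquare y / (2 * P)))) := by
  have hP' : P.toNNReal ≠ 0 := by simpa using hP
  have e1 : gaussianReal 0 P.toNNReal = volume.withDensity (gaussianPDF 0 P.toNNReal) :=
    gaussianReal_of_var_ne_zero _ hP'
  have i1 : IsProbabilityMeasure (volume.withDensity (gaussianPDF 0 P.toNNReal)) := by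
    rw [← e1]; infer_instance
  rw [gaussianCodeword, e1, pi_withDensity (fun _ : Fin n => volume)
    (fun _ => gaussianPDF 0 P.toNNReal) (fun _ => measurable_gaussianPDF _ _), volume_pi]
  congr with y
  rw [prod_gaussianPDF (fun _ => 0) hP]
  simp only [sub_zero]
  rw [sum_sq_eq hn]

theorem meanSquare_ofLp_smul {n : ℕ} (r : ℝ)
    (u : Metric.sphere (0 : EuclideanSpace ℝ (Fin n)) 1) :
    meanSquare (WithLp.ofLp (r • (u : EuclideanSpace ℝ (Fin n)))) = r ^ 2 / n := by
  have hu : ∑ i, (u : EuclideanSpace ℝ (Fin n)) i ^ 2 = 1 := by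
    have h := EuclideanSpace.real_norm_sq_eq (u : EuclideanSpace ℝ (Fin n))
    rw [← h]; simp
  rw [meanSquare]
  simp only [PiLp.smul_apply, smul_eq_mul, mul_pow, ← Finset.mul_sum]
  rw [hu]; ring

theorem normalize_ofLp_smul (P : ℝ) {n : ℕ} (hn : 0 < n) {r : ℝ} (hr : 0 < r)
    (u : Metric.sphere (0 : EuclideanSpace ℝ (Fin n)) 1) :
    normalize P (WithLp.ofLp (r • (u : EuclideanSpace ℝ (Fin n)))) =
      fun i => √((n : ℝ) * P) * (u : EuclideanSpace ℝ (Fin n)) i := by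
  have hnR : (0 : ℝ) < n := by exact_mod_cast hn
  ext i
  rw [normalize, meanSquare_ofLp_smul, Real.sqrt_div (sq_nonneg r), Real.sqrt_sq hr.le,
    Real.sqrt_mul hnR.le]
  have := (Real.sqrt_pos.mpr hnR).ne'
  simp only [PiLp.smul_apply, smul_eq_mul]
  field_simp

/-- The direction of a Gaussian codeword is uniform and independent of its power. -/
theorem gaussianCodeword_normalize_and_meanSquare {P : ℝ} (hP : 0 < P) {n : ℕ} (hn : 0 < n)
    {T : Set (Fin n → ℝ)} (hT : MeasurableSet T) {B : Set ℝ} (hB : MeasurableSet B) :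
    gaussianCodeword P n {y | normalize P y ∈ T ∧ meanSquare y ∈ B} =
      sphericalCodeword P n T * gaussianCodeword P n {y | meanSquare y ∈ B} := by
  have hnR : (0 : ℝ) < n := by exact_mod_cast hn
  have : Nonempty (Fin n) := ⟨⟨0, hn⟩⟩
  set S := (volume : Measure (EuclideanSpace ℝ (Fin n))).toSphere with hS
  set ρ := Measure.volumeIoiPow (Module.finrank ℝ (EuclideanSpace ℝ (Fin n)) - 1) with hρ
  set φ : Metric.sphere (0 : EuclideanSpace ℝ (Fin n)) 1 → Fin n → ℝ := fun u i =>
    √((n : ℝ) * P) * (u : EuclideanSpace ℝ (Fin n)) i with hφ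
  have hφm : Measurable φ := by
    refine measurable_pi_lambda _ fun i => ?_
    have : Continuous fun u : Metric.sphere (0 : EuclideanSpace ℝ (Fin n)) 1 =>
        (u : EuclideanSpace ℝ (Fin n)) i := by fun_prop
    exact this.measurable.const_mul _
  set h : ℝ → ENNReal := fun a =>
    ENNReal.ofReal ((√(2 * Real.pi * P))⁻¹ ^ n * Real.exp (-(n * a / (2 * P)))) with hh
  have hhm : Measurable h := by rw [hh]; fun_prop
  have polar : ∀ T : Set (Fin n → ℝ), MeasurableSet T →
      gaussianCodeword P n {y | normalize P y ∈ T ∧ meanSquare y ∈ B} =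
      S (φ ⁻¹' T) * ∫⁻ r : Set.Ioi (0 : ℝ), B.indicator h ((r : ℝ) ^ 2 / n) ∂ρ := by
    intro T hT
    have hm : MeasurableSet {y : Fin n → ℝ | normalize P y ∈ T ∧ meanSquare y ∈ B} :=
      (measurable_normalize P hT).inter (measurable_meanSquare hB)
    have hind : ∀ y : Fin n → ℝ,
        {y | normalize P y ∈ T ∧ meanSquare y ∈ B}.indicator (fun y => h (meanSquare y)) y =
        T.indicator 1 (normalize P y) * B.indicator h (meanSquare y) := by
      intro y
      by_cases h1 : normalize P y ∈ T <;> by_cases h2 : meanSquare y ∈ B <;> simp [h1, h2]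
    rw [gaussianCodeword_eq_withDensity hP hn, withDensity_apply _ hm, ← lintegral_indicator hm]
    have hG : Measurable fun y : Fin n → ℝ =>
        T.indicator (1 : (Fin n → ℝ) → ENNReal) (normalize P y) * B.indicator h (meanSquare y) :=
      ((measurable_one.indicator hT).comp (measurable_normalize P)).mul
        ((hhm.indicator hB).comp measurable_meanSquare)
    calc _ = ∫⁻ y : Fin n → ℝ,
          T.indicator (1 : (Fin n → ℝ) → ENNReal) (normalize P y) * B.indicator h (meanSquare y) :=
          lintegral_congr hind
      _ = ∫⁻ v : EuclideanSpace ℝ (Fin n),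
            T.indicator (1 : (Fin n → ℝ) → ENNReal) (normalize P (WithLp.ofLp v)) *
            B.indicator h (meanSquare (WithLp.ofLp v)) :=
          ((PiLp.volume_preserving_ofLp (Fin n)).lintegral_comp hG).symm
      _ = ∫⁻ p : Metric.sphere (0 : EuclideanSpace ℝ (Fin n)) 1 × Set.Ioi (0 : ℝ),
            (φ ⁻¹' T).indicator 1 p.1 * B.indicator h ((p.2 : ℝ) ^ 2 / n) ∂(S.prod ρ) := by
          rw [lintegral_eq_lintegral_toSphere_prod]
          refine lintegral_congr fun p => ?_
          rw [normalize_ofLp_smul P hn p.2.2, meanSquare_ofLp_smul]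
          rfl
      _ = _ := by
          rw [lintegral_prod_mul (f := (φ ⁻¹' T).indicator 1)
            (g := fun r : Set.Ioi (0 : ℝ) => B.indicator h ((r : ℝ) ^ 2 / n))
            (measurable_one.indicator (hφm hT)).aemeasurable
            ((hhm.indicator hB).comp (by fun_prop)).aemeasurable,
            lintegral_indicator_one (hφm hT)]
  have huniv := polar Set.univ .univ
  simp only [Set.mem_univ, true_and, Set.preimage_univ] at huniv
  rw [polar T hT, huniv, sphericalCodeword, Measure.map_apply hφm hT, Measure.smul_apply,
    smul_eq_mul]
  have hS0 : S Set.univ ≠ 0 := by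
    rw [Ne, Measure.measure_univ_eq_zero]; exact Measure.toSphere_ne_zero _
  have hStop : S Set.univ ≠ ⊤ := measure_ne_top _ _
  rw [← hS]
  calc _ = ((S Set.univ)⁻¹ * S Set.univ) * S (φ ⁻¹' T) * _ := by
        rw [ENNReal.inv_mul_cancel hS0 hStop, one_mul]
    _ = _ := by ring

theorem gaussianCodeword_normalize {P : ℝ} (hP : 0 < P) {n : ℕ} (hn : 0 < n)
    {T : Set (Fin n → ℝ)} (hT : MeasurableSet T) :
    gaussianCodeword P n {y | normalize P y ∈ T} = sphericalCodeword P n T := by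
  have h := gaussianCodeword_normalize_and_meanSquare hP hn hT MeasurableSet.univ
  have : gaussianCodeword P n Set.univ = 1 := by rw [gaussianCodeword]; exact measure_univ
  simpa [this] using h

theorem isProbabilityMeasure_sphericalCodeword {P : ℝ} (hP : 0 < P) {n : ℕ} (hn : 0 < n) :
    IsProbabilityMeasure (sphericalCodeword P n) := by
  refine ⟨?_⟩
  rw [← gaussianCodeword_normalize hP hn MeasurableSet.univ]
  simp only [Set.mem_univ, Set.ofPred_true]
  rw [gaussianCodeword]; exact measure_univ

/-! ### Spherical hitting probabilities -/

/-- A squared triangle inequality: Young's inequality with weight `δ` in each coordinate. -/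
theorem distortion_le_add {n : ℕ} (x y y' : Fin n → ℝ) {δ : ℝ} (hδ : 0 < δ) :
    distortion x y ≤ (1 + δ) * distortion x y' + (1 + 1 / δ) * distortion y' y := by
  have h : ∀ a b : ℝ, (a + b) ^ 2 ≤ (1 + δ) * a ^ 2 + (1 + 1 / δ) * b ^ 2 := by
    intro a b
    have e : (1 + δ) * a ^ 2 + (1 + 1 / δ) * b ^ 2 - (a + b) ^ 2 = (δ * a - b) ^ 2 / δ := by
      field_simp; ring
    have : 0 ≤ (δ * a - b) ^ 2 / δ := by positivity
    linarith
  have hs : ∑ i, (x i - y i) ^ 2 ≤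
      (1 + δ) * ∑ i, (x i - y' i) ^ 2 + (1 + 1 / δ) * ∑ i, (y' i - y i) ^ 2 := by
    rw [Finset.mul_sum, Finset.mul_sum, ← Finset.sum_add_distrib]
    refine Finset.sum_le_sum fun i _ => ?_
    have := h (x i - y' i) (y' i - y i)
    rwa [sub_add_sub_cancel] at this
  have := mul_le_mul_of_nonneg_left hs (by positivity : (0 : ℝ) ≤ 1 / n)
  simp only [distortion]
  linarith

theorem distortion_comm {n : ℕ} (x y : Fin n → ℝ) : distortion x y = distortion y x := by
  simp only [distortion]
  congr 1
  exact Finset.sum_congr rfl fun i _ => by ring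

theorem meanSquare_nonneg {n : ℕ} (x : Fin n → ℝ) : 0 ≤ meanSquare x := by
  unfold meanSquare; positivity

/-- Moving a sequence to power `P` costs a quadratically small distortion. For the zero sequence the
left side is `0`, since division by zero makes `normalize P 0 = 0`. -/
theorem distortion_normalize_le {P : ℝ} (hP : 0 < P) {n : ℕ} (y : Fin n → ℝ) :
    distortion (normalize P y) y ≤ (meanSquare y - P) ^ 2 / P := by
  set A := meanSquare y with hA
  have hA0 : 0 ≤ A := meanSquare_nonneg y
  have e : distortion (normalize P y) y = (√P / √A - 1) ^ 2 * A := by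
    calc distortion (normalize P y) y = 1 / n * ∑ i, (√P / √A - 1) ^ 2 * y i ^ 2 := by
          rw [distortion]
          congr 1
          refine Finset.sum_congr rfl fun i _ => ?_
          rw [normalize, ← hA]; ring
      _ = (√P / √A - 1) ^ 2 * (1 / n * ∑ i, y i ^ 2) := by rw [← Finset.mul_sum]; ring
  rw [e]
  rcases hA0.eq_or_lt with h | h
  · rw [← h]; simp; positivity
  · have hsA : 0 < √A := Real.sqrt_pos.mpr h
    have hsP : 0 < √P := Real.sqrt_pos.mpr hP
    have e2 : (√P / √A - 1) ^ 2 * A = (√P - √A) ^ 2 := by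
      nth_rewrite 2 [← Real.sq_sqrt hA0]
      field_simp
    have e3 : (A - P) ^ 2 = (√P - √A) ^ 2 * (√P + √A) ^ 2 := by
      nth_rewrite 1 [← Real.sq_sqrt hA0, ← Real.sq_sqrt hP.le]
      ring
    have e4 : P ≤ (√P + √A) ^ 2 := by
      nth_rewrite 1 [← Real.sq_sqrt hP.le]
      gcongr; linarith
    rw [e2, le_div_iff₀ hP, e3]
    gcongr

/-- The normalization of a typical Gaussian codeword is close to the codeword itself, so the margin
in `eventually_le_gaussianCodeword` absorbs the difference. -/
theorem sphericalCodeword_hit {s D : ℝ} (hD : 0 < D) (hDs : D < s) {ξ : ℕ → ℝ}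
    (hξ : Tendsto ξ atTop (𝓝 0)) (hpos : ∀ᶠ n in atTop, 0 < ξ n)
    (hinf : Tendsto (fun n : ℕ => n * ξ n ^ 2) atTop atTop) {ε : ℝ} (hε : 0 < ε) :
    ∀ᶠ n : ℕ in atTop, ∀ x : Fin n → ℝ, s - 2 * s * ξ n ≤ meanSquare x →
      meanSquare x ≤ s + 2 * s * ξ n * (1 - ε) →
      ENNReal.ofReal (Real.exp (-(n * (rateDistortion s D + ξ n) - n * ξ n * (ε / 2)))) ≤
        sphericalCodeword (s - D) n {y | distortion x y ≤ D} := by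
  have hP : 0 < s - D := by linarith
  obtain ⟨κ, hκ, hκ1, h⟩ := eventually_le_gaussianCodeword hD hDs hξ hpos hinf
    (C := D + 18 / (s - D)) (by positivity) hε
  filter_upwards [h, hpos, eventually_gt_atTop 0, hξ.eventually_lt_const one_pos]
    with n hn hξn hn0 hξ1 x h1 h2
  rw [← gaussianCodeword_normalize hP hn0 (measurableSet_distortion_le x D)]
  refine (hn x h1 h2).trans (measure_mono fun y hy => ?_)
  obtain ⟨hy1, hy2⟩ := hy
  set δ := κ * ξ n with hδ
  have hδ0 : 0 < δ := by positivity
  have hδ1 : δ ≤ 1 := mul_le_one₀ hκ1 hξn.le hξ1.le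
  have k1 := distortion_le_add x (normalize (s - D) y) y hδ0
  have k2 : distortion y (normalize (s - D) y) ≤ 9 * δ ^ 2 / (s - D) := by
    rw [distortion_comm]
    refine (distortion_normalize_le hP y).trans ?_
    gcongr
    calc (meanSquare y - (s - D)) ^ 2 ≤ (3 * δ) ^ 2 := sq_le_sq' (abs_le.mp hy2).1 (abs_le.mp hy2).2
      _ = _ := by ring
  show distortion x (normalize (s - D) y) ≤ D
  calc distortion x (normalize (s - D) y)
      ≤ (1 + δ) * (D - (D + 18 / (s - D)) * δ) + (1 + 1 / δ) * (9 * δ ^ 2 / (s - D)) := by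
        refine k1.trans ?_
        gcongr
    _ = D - δ ^ 2 * D - 9 * (1 + δ) * δ / (s - D) := by field_simp; ring
    _ ≤ D := by
        have : 0 ≤ δ ^ 2 * D := by positivity
        have : 0 ≤ 9 * (1 + δ) * δ / (s - D) := by positivity
        linarith

/-- A spherical codeword within distortion `D` of `x`, moved to the power of an independent
Gaussian codeword, stays within `D + O(δ)`; this reduces the bound to the Gaussian one. -/
theorem sphericalCodeword_miss {s D : ℝ} (hD : 0 < D) (hDs : D < s) {ξ : ℕ → ℝ}
    (hξ : Tendsto ξ atTop (𝓝 0)) (hpos : ∀ᶠ n in atTop, 0 < ξ n)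
    (hinf : Tendsto (fun n : ℕ => n * ξ n ^ 2) atTop atTop) {ε : ℝ} (hε : 0 < ε) :
    ∀ᶠ n : ℕ in atTop, ∀ x : Fin n → ℝ, s + 2 * s * ξ n * (1 + ε) ≤ meanSquare x →
      sphericalCodeword (s - D) n {y | distortion x y ≤ D} ≤
        ENNReal.ofReal (Real.exp (-(n * (rateDistortion s D + ξ n) + n * ξ n * (ε / 2)))) := by
  have hs : 0 < s := hD.trans hDs
  set P := s - D with hPdef
  have hP : 0 < P := by rw [hPdef]; linarith
  set c := (D + 2 / P) / (2 * D) with hc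
  have hcpos : 0 < c := by positivity
  obtain ⟨κ, hκ, hκ1, hκ2⟩ : ∃ κ : ℝ, 0 < κ ∧ κ ≤ 1 ∧ κ * c ≤ ε / 4 := by
    refine ⟨min 1 (ε / 4 / c), by positivity, min_le_left _ _, ?_⟩
    rw [← le_div_iff₀ hcpos]
    exact min_le_right _ _
  set K := Var[fun g : ℝ => g ^ 2; gaussianReal 0 1] with hK
  filter_upwards [hpos, eventually_gt_atTop 0, hξ.eventually_lt_const one_pos,
    hinf.eventually_ge_atTop (4 * (P ^ 2 * K) / κ ^ 2),
    hinf.eventually_ge_atTop (Real.log 2 / (ε / 4))] with n hξn hn hξ1 b1 b2 x hx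
  have hnR : (0 : ℝ) < n := by exact_mod_cast hn
  rw [div_le_iff₀ (by positivity)] at b1 b2
  set t := ξ n with ht
  set δ := κ * t with hδ
  have hδ0 : 0 < δ := by positivity
  have hδ1 : δ ≤ 1 := mul_le_one₀ hκ1 hξn.le hξ1.le
  set B : Set ℝ := {a | |a - P| ≤ δ} with hB
  have hBm : MeasurableSet B := measurableSet_le (by fun_prop) measurable_const
  have hhalf : ENNReal.ofReal (1 / 2) ≤ gaussianCodeword P n {y | meanSquare y ∈ B} := by
    -- for the zero sequence typicality only constrains the power
    have h := half_le_typicalSet hn (0 : Fin n → ℝ) 0 hP hδ0 (by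
      have : n * δ ^ 2 = n * t ^ 2 * κ ^ 2 := by rw [hδ]; ring
      rw [this]; linarith) (by simp [meanSquare]; positivity)
    simp only [zero_mul] at h
    refine h.trans (measure_mono fun y hy => ?_)
    have h1 : |∑ i, (y i ^ 2 - P)| < n * δ := by simpa using hy.1
    rw [sum_sq_sub_eq hn, abs_mul, abs_of_pos hnR] at h1
    exact (lt_of_mul_lt_mul_left h1 hnR.le).le
  have hprod := gaussianCodeword_normalize_and_meanSquare hP hn
    (measurableSet_distortion_le x D) hBm
  have hsub : {y : Fin n → ℝ | normalize P y ∈ {y | distortion x y ≤ D} ∧ meanSquare y ∈ B} ⊆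
      {y | distortion x y ≤ D + δ * (D + 2 / P)} := by
    rintro y ⟨hy1, hy2⟩
    have hy1' : distortion x (normalize P y) ≤ D := hy1
    have hy2' : |meanSquare y - P| ≤ δ := hy2
    have k2 : distortion (normalize P y) y ≤ δ ^ 2 / P := by
      refine (distortion_normalize_le hP y).trans ?_
      have := sq_le_sq' (abs_le.mp hy2').1 (abs_le.mp hy2').2
      gcongr
    show distortion x y ≤ D + δ * (D + 2 / P)
    calc distortion x y ≤ (1 + δ) * D + (1 + 1 / δ) * (δ ^ 2 / P) := by
          refine (distortion_le_add x y (normalize P y) hδ0).trans ?_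
          gcongr
      _ = D + δ * (D + (1 + δ) / P) := by field_simp; ring
      _ ≤ _ := by gcongr; linarith
  have hG := gaussianCodeword_distortion_le hD hDs hn x (D + δ * (D + 2 / P))
  rw [← hPdef] at hG
  have hkey := hprod.symm.le.trans ((measure_mono hsub).trans hG)
  set L := n * (rateDistortion s D + (meanSquare x - s) / (2 * s) -
    (D + δ * (D + 2 / P) - D) / (2 * D)) with hL
  have h2 : sphericalCodeword P n {y | distortion x y ≤ D} * ENNReal.ofReal (1 / 2) ≤
      ENNReal.ofReal (Real.exp (-L)) := (mul_le_mul_right hhalf _).trans hkey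
  have hLge : n * (rateDistortion s D + t) + n * t * (ε / 2) + Real.log 2 ≤ L := by
    have h1 : t * (1 + ε) ≤ (meanSquare x - s) / (2 * s) := by
      rw [le_div_iff₀ (by positivity)]; linarith
    have h2 : (D + δ * (D + 2 / P) - D) / (2 * D) ≤ t * (ε / 4) := by
      calc _ = t * (κ * c) := by rw [hδ, hc]; ring
        _ ≤ _ := by gcongr
    have h3 : Real.log 2 ≤ n * (t * (ε / 4)) := by
      refine b2.trans ?_
      have : t ^ 2 ≤ t := by rw [sq]; exact mul_le_of_le_one_left hξn.le hξ1.le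
      calc n * t ^ 2 * (ε / 4) ≤ n * t * (ε / 4) := by gcongr
        _ = _ := by ring
    have h4 : rateDistortion s D + t + t * (ε / 2) + t * (ε / 4) ≤
        rateDistortion s D + (meanSquare x - s) / (2 * s) -
          (D + δ * (D + 2 / P) - D) / (2 * D) := by linarith
    have := mul_le_mul_of_nonneg_left h4 hnR.le
    linarith
  calc sphericalCodeword P n {y | distortion x y ≤ D}
      = sphericalCodeword P n {y | distortion x y ≤ D} * ENNReal.ofReal (1 / 2) *
          ENNReal.ofReal 2 := by
        rw [mul_assoc, ← ENNReal.ofReal_mul (by norm_num)]; norm_num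
    _ ≤ ENNReal.ofReal (Real.exp (-L)) * ENNReal.ofReal 2 := mul_le_mul_left h2 _
    _ = ENNReal.ofReal (Real.exp (-L + Real.log 2)) := by
        rw [← ENNReal.ofReal_mul (Real.exp_pos _).le, Real.exp_add, Real.exp_log (by norm_num)]
    _ ≤ _ := ENNReal.ofReal_le_ofReal (Real.exp_le_exp.mpr (by linarith))

end RDSaddle

end

theorem theorem2 (μ : Measure ℝ) [IsProbabilityMeasure μ] (σ ζ D : ℝ)
    (h2 : Integrable (fun x : ℝ => x ^ 2) μ) (hσ : ∫ x, x ^ 2 ∂μ = σ ^ 2)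
    (h4 : Integrable (fun x : ℝ => x ^ 4) μ) (hζ : ∫ x, x ^ 4 ∂μ = ζ)
    (h6 : Integrable (fun x : ℝ => x ^ 6) μ)
    (hcgf : ∃ θ : ℝ, 0 < θ ∧ Integrable (fun x : ℝ => Real.exp (θ * x ^ 2)) μ)
    (hD : 0 < D) (hDσ : D < σ ^ 2)
    (hV : 0 < RDSaddle.mismatchedDispersion (σ ^ 2) ζ)
    (ξ : ℕ → ℝ) (hξ : Tendsto ξ atTop (𝓝 0))
    (hξ' : Tendsto (fun n : ℕ => √((n : ℝ) / Real.log n) * ξ n) atTop atTop) :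
    RDSaddle.nuSpherical μ (σ ^ 2) D ξ =
        ((1 / (2 * RDSaddle.mismatchedDispersion (σ ^ 2) ζ) : ℝ) : EReal) ∧
      RDSaddle.nuGaussian μ (σ ^ 2) D ξ =
        ((1 / (2 * RDSaddle.mismatchedDispersion (σ ^ 2) ζ) : ℝ) : EReal) := by
  have hpos := RDSaddle.eventually_pos_of_moderate hξ'
  have hinf := RDSaddle.tendsto_mul_sq_of_moderate hξ'
  constructor
  · refine RDSaddle.moderateDeviationsConstant_eq h2 hσ h4 hζ hcgf hD hDσ hV hξ hξ' ?_
      (fun ε hε => RDSaddle.sphericalCodeword_hit hD hDσ hξ hpos hinf hε)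
      (fun ε hε => RDSaddle.sphericalCodeword_miss hD hDσ hξ hpos hinf hε)
    filter_upwards [eventually_gt_atTop 0] with n hn
    exact RDSaddle.isProbabilityMeasure_sphericalCodeword (by linarith) hn
  · refine RDSaddle.moderateDeviationsConstant_eq h2 hσ h4 hζ hcgf hD hDσ hV hξ hξ' ?_
      (fun ε hε => RDSaddle.gaussianCodeword_hit hD hDσ hξ hpos hinf hε)
      (fun ε hε => RDSaddle.gaussianCodeword_miss hD hDσ hpos hε)
    refine Eventually.of_forall fun n => ?_
    rw [RDSaddle.gaussianCodeword]
    infer_instance
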